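/- Let $A=(a_{ij})_{i,j\in I}$ be the Cartan matrix of a finite-dimensional simple complex Lie algebra, $(\cdot|\cdot)$ its normalized invariant form on the root lattice $Q=\bigoplus_{i\in I}\mathbb Z\alpha_i$ (long roots have square length $2$), let $q\in\mathbb C^*$ not be a root of unity, fix $h$ with $q=e^h$, and put $q_{ij}=q^{(\alpha_i|\alpha_j)}:=e^{h(\alpha_i|\alpha_j)}$. Let $g_{ij}(t)=\sum_{n\ge0}g^{(ij)}_nt^n$ be the Taylor series at $0$ of $(q_{ij}t-1)/(t-q_{ij})$. Let $\bar U_q(\mathfrak b^+)$ be the free unital $\mathbb C$-algebra on symbols $x^+_{i,n}$, $\varphi_{i,l}$, $\varphi_{i,0}^{-1}$, $q^{\pm c/2}$ and $\bar U_q(\mathfrak b^-)$ the free unital $\mathbb C$-algebra on symbols $x^-_{i,n}$, $\psi_{i,k}$, $\psi_{i,0}^{-1}$, $q^{\pm c'/2}$ ($i\in I$, $n\in\mathbb Z$, $l\le0$, $k\ge0$), graded by $Q$ with $\deg x^\pm_{i,n}=\pm\alpha_i$ and all other generators of degree $0$. Put $x_i^\pm(z)=\sum_n x^\pm_{i,n}z^{-n}$,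 $\varphi_i(z)=\sum_{l\le0}\varphi_{i,l}z^{-l}$, $\psi_i(z)=\sum_{k\ge0}\psi_{i,k}z^{-k}$. Let $\Delta_\pm$ be the multiplicative maps, with values in possibly infinite linear combinations of tensors of two words, for which $q^{\pm c/2},q^{\pm c'/2},\varphi_{i,0}^{-1},\psi_{i,0}^{-1}$ are group-like and $$\Delta_+(x_i^+(z))=x_i^+(z)\otimes1+\varphi_i(zq^{c_1/2})\otimes x_i^+(zq^{c_1}),\qquad \Delta_+(\varphi_i(z))=\varphi_i(zq^{-c_2/2})\otimes\varphi_i(zq^{c_1/2}),$$ $$\Delta_-(x_i^-(z))=1\otimes x_i^-(z)+x_i^-(zq^{c'_2})\otimes\psi_i(zq^{c'_2/2}),\qquad \Delta_-(\psi_i(z))=\psi_i(zq^{c'_2/2})\otimes\psi_i(zq^{-c'_1/2}),$$ where $c_1=c\otimes1$, $c_2=1\otimes c$, and similarly for $c'$. Let $\varepsilon$ be the algebra maps to $\mathbb C$ with $\varepsilon(x^\pm_{i,n})=0$, $\varepsilon(\varphi_{i,-k})=\varepsilon(\psi_{i,k})=\delta_{k,0}$ and value $1$ on the other generators. Let $S$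 on $\bar U_q(\mathfrak b^-)$ and $S^{-1}$ on $\bar U_q(\mathfrak b^+)$ be the antimultiplicative maps, with values in possibly infinite linear combinations of words, given by $S(q^{\pm c'/2})=q^{\mp c'/2}$, $S(\psi_i(z))=\psi_i(z)^{-1}$, $S(\psi_{i,0}^{-1})=\psi_{i,0}$, $S(x^-_i(z))=-x_i^-(zq^{-c'})\psi_i(zq^{-c'/2})^{-1}$ and $S^{-1}(q^{\pm c/2})=q^{\mp c/2}$, $S^{-1}(\varphi_i(z))=\varphi_i(z)^{-1}$, $S^{-1}(\varphi_{i,0}^{-1})=\varphi_{i,0}$, $S^{-1}(x^+_i(z))=-x_i^+(zq^{-c})\varphi_i(zq^{-c/2})^{-1}$; the inverse series are formed with the symbols $\varphi_{i,0}^{-1},\psi_{i,0}^{-1}$ as inverses of the constant terms. A weak Hopf pairing is a bilinear form $\langle\cdot,\cdot\rangle:\bar U_q(\mathfrak b^+)\times\bar U_q(\mathfrak b^-)\to\mathbb C$ such that for all $a,a',b,b'$ $$\langle a,bb'\rangle=\sum\langle a_{(1)},b\rangle\langle a_{(2)},b'\rangle,\quad \langle aa',b\rangle=\sum\langle a,b_{(2)}\rangle\langle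 a',b_{(1)}\rangle,$$ $$\langle a,1\rangle=\varepsilon(a),\quad\langle1,b\rangle=\varepsilon(b),\quad \langle S^{-1}(a),b\rangle=\langle a,S(b)\rangle,$$ where each of the sums over the words in $\Delta_+(a)$, $\Delta_-(b)$, $S^{-1}(a)$, $S(b)$ has only finitely many nonzero summands. It is $Q$-graded if homogeneous elements of degrees $\alpha,\beta$ with $\alpha+\beta\ne0$ pair to zero. Then there is a unique $Q$-graded weak Hopf pairing such that for all $i,j\in I$, $n,m\in\mathbb Z$, $k\ge0$, $l\le0$ (all choices of signs independent) $$\langle q^{\pm c/2},q^{\pm c'/2}\rangle=1,\quad \langle q^{\pm c/2},\psi_{i,k}\rangle=\langle\varphi_{i,-k},q^{\pm c'/2}\rangle=\delta_{k,0},\quad \langle q^{\pm c/2},\psi_{i,0}^{-1}\rangle=\langle\varphi_{i,0}^{-1},q^{\pm c'/2}\rangle=1,$$ $$\langle q^{\pm c/2},x^-_{i,n}\rangle=\langle x^+_{i,n},q^{\pm c'/2}\rangle=0,\quad \langle\varphi_{i,l},x^-_{j,n}\rangle=\langle x^+_{j,n},\psi_{i,k}\rangle=0,\quad \langle\varphi_{i,l},\psi_{j,k}\rangle=g^{(ij)}_k\delta_{k,-l},$$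 $$\langle\varphi_{i,0}^{-1},\psi_{j,0}\rangle=\langle\varphi_{i,0},\psi_{j,0}^{-1}\rangle=(g_0^{(ij)})^{-1},\quad \langle x^+_{i,n},x^-_{j,m}\rangle=-\frac{\delta_{ij}\delta_{n,-m}}{q+q^{-1}}.$$ Moreover, the following elements lie in its left annihilator: those expressing that $q^{\pm c/2}$ are central and mutually inverse, that $\varphi_{i,0}\varphi_{i,0}^{-1}=\varphi_{i,0}^{-1}\varphi_{i,0}=1$, that $\varphi_i(z)\varphi_j(w)=\varphi_j(w)\varphi_i(z)$, and that $\varphi_i(z)x_j^+(w)=g_{ij}(zw^{-1}q^{-c/2})x_j^+(w)\varphi_i(z)$. Similarly, its right annihilator contains the elements expressing that $q^{\pm c'/2}$ are central and mutually inverse, that $\psi_{i,0}\psi_{i,0}^{-1}=\psi_{i,0}^{-1}\psi_{i,0}=1$, that $\psi_i(z)\psi_j(w)=\psi_j(w)\psi_i(z)$, and that $\psi_i(z)x_j^-(w)=g_{ij}(wz^{-1}q^{c'/2})x_j^-(w)\psi_i(z)$. -/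

import Mathlib

noncomputable section

namespace QuantumAffine

/-! ## Cartan data -/

/-- The Cartan matrix of a finite-dimensional simple complex Lie algebra: an indecomposable
generalized Cartan matrix which is symmetrizable with positive definite symmetrization. -/
structure IsSimpleCartanMatrix {I : Type*} [Fintype I] [DecidableEq I]
    (A : Matrix I I ℤ) : Prop where
  diag : ∀ i, A i i = 2
  off_diag : ∀ i j, i ≠ j → A i j ≤ 0
  zero_symm : ∀ i j, A i j = 0 → A j i = 0
  indecomposable : ∀ s : Set I, s.Nonempty → sᶜ.Nonempty → ∃ i ∈ s, ∃ j ∈ sᶜ, A i j ≠ 0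
  finite_type : ∃ d : I → ℝ, (∀ i, 0 < d i) ∧
    (Matrix.diagonal d * A.map (fun n : ℤ => (n : ℝ))).PosDef

/-- `B i j = (α_i | α_j)`: the values on simple roots of the normalized invariant form
(the long roots have square length `2`), so `a_ij = 2 (α_i | α_j) / (α_i | α_i)`. -/
structure IsNormalizedForm {I : Type*} (A : Matrix I I ℤ) (B : Matrix I I ℚ) : Prop where
  symm : ∀ i j, B i j = B j i
  pos : ∀ i, 0 < B i i
  cartan : ∀ i j, 2 * B i j = B i i * (A i j : ℚ)
  le_two : ∀ i, B i i ≤ 2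
  eq_two : ∃ i, B i i = 2

/-- `q_ij = q ^ (α_i | α_j)`, where `q = exp h` and `q ^ s` means `exp (s h)`. -/
def qij {I : Type*} (h : ℂ) (B : Matrix I I ℚ) (i j : I) : ℂ := Complex.exp (h * ((B i j : ℚ) : ℂ))

/-- `gSeries a` is the Taylor series at `t = 0` of `(a t - 1) / (t - a)`. -/
def gSeries (a : ℂ) : PowerSeries ℂ :=
  (PowerSeries.C a * PowerSeries.X - 1) * (PowerSeries.X - PowerSeries.C a)⁻¹

/-- `g_n^{(ij)}`, where `Q i j = q_ij`. -/
def gCoeff {I : Type*} (Q : I → I → ℂ) (i j : I) (n : ℕ) : ℂ :=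
  PowerSeries.coeff n (gSeries (Q i j))

/-! ## Free algebras, formal series in words

An element of a completion of the free algebra on `G` (of its tensor square) is a possibly
infinite linear combination of words (of pairs of words), and is given by the family of its
coefficients, a function `List G → ℂ` (`List G → List G → ℂ`). -/

section Free

variable {G : Type*}

/-- The monomial of a word. -/
def mono (w : List G) : FreeAlgebra ℂ G := (w.map (FreeAlgebra.ι ℂ)).prod

/-- The coefficient of an element of the free algebra at a word. -/
def coeff (a : FreeAlgebra ℂ G) (w : List G) : ℂ :=
  (FreeAlgebra.basisFreeMonoid ℂ G).repr a (FreeMonoid.ofList w)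

/-- The coefficients of `a ⊗ b` at the pairs of words. -/
def tmul (a b : FreeAlgebra ℂ G) (u v : List G) : ℂ := coeff a u * coeff b v

/-- The coefficients of `D g₁ * D g₂ * ⋯ * D gₙ` (product of formal series in the completed
tensor square) for the word `g₁ g₂ ⋯ gₙ`. -/
def comulWord (D : G → List G → List G → ℂ) : List G → List G → List G → ℂ
  | [], u, v => tmul 1 1 u v
  | g :: w, u, v => ∑ i ∈ Finset.range (u.length + 1), ∑ j ∈ Finset.range (v.length + 1),
      D g (u.take i) (v.take j) * comulWord D w (u.drop i) (v.drop j)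

/-- The multiplicative linear extension of `D` to the free algebra, with values in the
completed tensor square. -/
def comulExt (D : G → List G → List G → ℂ) (a : FreeAlgebra ℂ G) (u v : List G) : ℂ :=
  ((FreeAlgebra.basisFreeMonoid ℂ G).repr a).sum
    fun w c => c * comulWord D (FreeMonoid.toList w) u v

/-- The coefficients of `T gₙ * ⋯ * T g₂ * T g₁` (product of formal series) for the word
`g₁ g₂ ⋯ gₙ`. -/
def antiWord (T : G → List G → ℂ) : List G → List G → ℂ
  | [], u => coeff 1 u
  | g :: w, u => ∑ i ∈ Finset.range (u.length + 1), antiWord T w (u.take i) * T g (u.drop i)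

/-- The anti-multiplicative linear extension of `T` to the free algebra, with values in the
completion. -/
def antiExt (T : G → List G → ℂ) (a : FreeAlgebra ℂ G) (u : List G) : ℂ :=
  ((FreeAlgebra.basisFreeMonoid ℂ G).repr a).sum
    fun w c => c * antiWord T (FreeMonoid.toList w) u

/-- The span of the words of degree `α`, for a degree function on letters. -/
def homogeneous {Γ : Type*} [AddMonoid Γ] (d : G → Γ) (α : Γ) : Submodule ℂ (FreeAlgebra ℂ G) :=
  Submodule.span ℂ (mono '' {w : List G | (w.map d).sum = α})

end Free

/-- Integer powers of `a`, with `b` playing the role of the inverse of `a`. -/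
def zpowWith {R : Type*} [Monoid R] (a b : R) : ℤ → R
  | Int.ofNat n => a ^ n
  | Int.negSucc n => b ^ (n + 1)

/-- The coefficients of the inverse `f(z)⁻¹` of a series `f(z) = ∑ f n z^n`, where `b` plays the
role of the inverse of `f 0`. -/
def invCoeff {R : Type*} [Ring R] (f : ℕ → R) (b : R) : ℕ → R
  | 0 => b
  | n + 1 => -(b * ∑ s : Fin (n + 1), f (n + 1 - s.1) * invCoeff f b s.1)

/-! ## The positive side -/

/-- Generators on the positive side: `x i n` is `x⁺_{i,n}`, `phi i k` is `φ_{i,-k}`, `phiInv i`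
is `φ_{i,0}⁻¹`, `qc` and `qcInv` are `q^{c/2}` and `q^{-c/2}`. -/
inductive PosGen (I : Type*) where
  | x (i : I) (n : ℤ)
  | phi (i : I) (k : ℕ)
  | phiInv (i : I)
  | qc
  | qcInv

/-- The free algebra on the positive generators. -/
abbrev UPos (I : Type*) := FreeAlgebra ℂ (PosGen I)

namespace UPos

variable {I : Type*}

def x (i : I) (n : ℤ) : UPos I := FreeAlgebra.ι ℂ (PosGen.x i n)
/-- `phi i k` is `φ_{i,-k}`. -/
def phi (i : I) (k : ℕ) : UPos I := FreeAlgebra.ι ℂ (PosGen.phi i k)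
def phiInv (i : I) : UPos I := FreeAlgebra.ι ℂ (PosGen.phiInv i)
def qc : UPos I := FreeAlgebra.ι ℂ PosGen.qc
def qcInv : UPos I := FreeAlgebra.ι ℂ PosGen.qcInv
/-- `K e` is `q^{e c/2}`. -/
def K (e : ℤ) : UPos I := zpowWith qc qcInv e
/-- `phiS i k` is the coefficient of `z^k` in `φ_i(z)⁻¹`. -/
def phiS (i : I) (k : ℕ) : UPos I := invCoeff (phi i) (phiInv i) k

/-- The coproduct `Δ₊` on generators:
`Δ(x_i(z)) = x_i(z) ⊗ 1 + φ_i(z q^{c₁/2}) ⊗ x_i(z q^{c₁})` and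
`Δ(φ_i(z)) = φ_i(z q^{-c₂/2}) ⊗ φ_i(z q^{c₁/2})`. -/
def comulGen : PosGen I → List (PosGen I) → List (PosGen I) → ℂ
  | .x i n, u, v => tmul (x i n) 1 u v
      + ∑ᶠ k : ℕ, tmul (phi i k * K (-(2 * n + k))) (x i (n + k)) u v
  | .phi i k, u, v => ∑ p ∈ Finset.HasAntidiagonal.antidiagonal k,
      tmul (phi i p.1 * K (p.2 : ℤ)) (phi i p.2 * K (-(p.1 : ℤ))) u v
  | .phiInv i, u, v => tmul (phiInv i) (phiInv i) u v
  | .qc, u, v => tmul qc qc u v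
  | .qcInv, u, v => tmul qcInv qcInv u v

/-- The coefficients of `Δ₊(a)` at the pairs of words. -/
def comul (a : UPos I) : List (PosGen I) → List (PosGen I) → ℂ := comulExt comulGen a

/-- The counit. -/
def counit : UPos I →ₐ[ℂ] ℂ := FreeAlgebra.lift ℂ fun g => match g with
  | .x _ _ => 0
  | .phi _ k => if k = 0 then 1 else 0
  | .phiInv _ => 1
  | .qc => 1
  | .qcInv => 1

/-- The inverse antipode `S⁻¹` on generators: `S⁻¹(φ_i(z)) = φ_i(z)⁻¹` and
`S⁻¹(x_i(z)) = - x_i(z q^{-c}) φ_i(z q^{-c/2})⁻¹`. It is the inverse of the antipode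
`S(φ_i(z)) = φ_i(z)⁻¹`, `S(x_i(z)) = - φ_i(z q^{-c/2})⁻¹ x_i(z q^{-c})`. -/
def antipodeInvGen : PosGen I → List (PosGen I) → ℂ
  | .x i n, u => ∑ᶠ k : ℕ, coeff (-(x i (n + k) * K (2 * (n + k)) * (phiS i k * K (-(k : ℤ))))) u
  | .phi i k, u => coeff (phiS i k) u
  | .phiInv i, u => coeff (phi i 0) u
  | .qc, u => coeff qcInv u
  | .qcInv, u => coeff qc u

/-- The coefficients of `S⁻¹(a)` at the words. -/
def antipodeInv (a : UPos I) : List (PosGen I) → ℂ := antiExt antipodeInvGen a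

/-- Degrees in the root lattice: `x⁺_{i,n}` has degree `α_i`, the other generators degree `0`. -/
def deg [DecidableEq I] : PosGen I → (I → ℤ)
  | .x i _ => Pi.single i 1
  | _ => 0

/-- The elements which vanish by the defining relations:
`q^{±c/2}` are central and mutually inverse, `φ_{i,0}` and `φ_{i,0}⁻¹` are mutually inverse,
`φ_i(z) φ_j(w) = φ_j(w) φ_i(z)` and
`φ_i(z) x_j(w) = g_ij(z w⁻¹ q^{-c/2}) x_j(w) φ_i(z)`, with `Q i j = q_ij`. -/
inductive Rel (Q : I → I → ℂ) : UPos I → Prop where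
  | qc_central (a : UPos I) : Rel Q (qc * a - a * qc)
  | qcInv_central (a : UPos I) : Rel Q (qcInv * a - a * qcInv)
  | qc_mul_qcInv : Rel Q (qc * qcInv - 1)
  | qcInv_mul_qc : Rel Q (qcInv * qc - 1)
  | phi_mul_phiInv (i : I) : Rel Q (phi i 0 * phiInv i - 1)
  | phiInv_mul_phi (i : I) : Rel Q (phiInv i * phi i 0 - 1)
  | phi_comm (i j : I) (k l : ℕ) : Rel Q (phi i k * phi j l - phi j l * phi i k)
  | phi_x (i j : I) (k : ℕ) (m : ℤ) : Rel Q (phi i k * x j m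
      - ∑ p ∈ Finset.HasAntidiagonal.antidiagonal k,
          gCoeff Q i j p.1 • (K (-(p.1 : ℤ)) * x j (m - p.1) * phi i p.2))

end UPos

/-! ## The negative side -/

/-- Generators on the negative side: `x i n` is `x⁻_{i,n}`, `psi i k` is `ψ_{i,k}`, `psiInv i`
is `ψ_{i,0}⁻¹`, `qc` and `qcInv` are `q^{c'/2}` and `q^{-c'/2}`. -/
inductive NegGen (I : Type*) where
  | x (i : I) (n : ℤ)
  | psi (i : I) (k : ℕ)
  | psiInv (i : I)
  | qc
  | qcInv

/-- The free algebra on the negative generators. -/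
abbrev UNeg (I : Type*) := FreeAlgebra ℂ (NegGen I)

namespace UNeg

variable {I : Type*}

def x (i : I) (n : ℤ) : UNeg I := FreeAlgebra.ι ℂ (NegGen.x i n)
def psi (i : I) (k : ℕ) : UNeg I := FreeAlgebra.ι ℂ (NegGen.psi i k)
def psiInv (i : I) : UNeg I := FreeAlgebra.ι ℂ (NegGen.psiInv i)
def qc : UNeg I := FreeAlgebra.ι ℂ NegGen.qc
def qcInv : UNeg I := FreeAlgebra.ι ℂ NegGen.qcInv
/-- `K e` is `q^{e c'/2}`. -/
def K (e : ℤ) : UNeg I := zpowWith qc qcInv e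
/-- `psiS i k` is the coefficient of `z^{-k}` in `ψ_i(z)⁻¹`. -/
def psiS (i : I) (k : ℕ) : UNeg I := invCoeff (psi i) (psiInv i) k

/-- The coproduct `Δ₋` on generators:
`Δ(x_i(z)) = 1 ⊗ x_i(z) + x_i(z q^{c₂}) ⊗ ψ_i(z q^{c₂/2})` and
`Δ(ψ_i(z)) = ψ_i(z q^{c₂/2}) ⊗ ψ_i(z q^{-c₁/2})`. -/
def comulGen : NegGen I → List (NegGen I) → List (NegGen I) → ℂ
  | .x i n, u, v => tmul 1 (x i n) u v
      + ∑ᶠ k : ℕ, tmul (x i (n - k)) (psi i k * K (-(2 * n - k))) u v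
  | .psi i k, u, v => ∑ p ∈ Finset.HasAntidiagonal.antidiagonal k,
      tmul (psi i p.1 * K (p.2 : ℤ)) (psi i p.2 * K (-(p.1 : ℤ))) u v
  | .psiInv i, u, v => tmul (psiInv i) (psiInv i) u v
  | .qc, u, v => tmul qc qc u v
  | .qcInv, u, v => tmul qcInv qcInv u v

/-- The coefficients of `Δ₋(b)` at the pairs of words. -/
def comul (b : UNeg I) : List (NegGen I) → List (NegGen I) → ℂ := comulExt comulGen b

/-- The counit. -/
def counit : UNeg I →ₐ[ℂ] ℂ := FreeAlgebra.lift ℂ fun g => match g with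
  | .x _ _ => 0
  | .psi _ k => if k = 0 then 1 else 0
  | .psiInv _ => 1
  | .qc => 1
  | .qcInv => 1

/-- The antipode `S` on generators: `S(ψ_i(z)) = ψ_i(z)⁻¹` and
`S(x_i(z)) = - x_i(z q^{-c'}) ψ_i(z q^{-c'/2})⁻¹`. -/
def antipodeGen : NegGen I → List (NegGen I) → ℂ
  | .x i n, u => ∑ᶠ k : ℕ, coeff (-(x i (n - k) * K (2 * (n - k)) * (psiS i k * K (k : ℤ)))) u
  | .psi i k, u => coeff (psiS i k) u
  | .psiInv i, u => coeff (psi i 0) u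
  | .qc, u => coeff qcInv u
  | .qcInv, u => coeff qc u

/-- The coefficients of `S(b)` at the words. -/
def antipode (b : UNeg I) : List (NegGen I) → ℂ := antiExt antipodeGen b

/-- Degrees in the root lattice: `x⁻_{i,n}` has degree `-α_i`, the other generators degree `0`. -/
def deg [DecidableEq I] : NegGen I → (I → ℤ)
  | .x i _ => -Pi.single i 1
  | _ => 0

/-- The elements which vanish by the defining relations:
`q^{±c'/2}` are central and mutually inverse, `ψ_{i,0}` and `ψ_{i,0}⁻¹` are mutually inverse,
`ψ_i(z) ψ_j(w) = ψ_j(w) ψ_i(z)` and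
`ψ_i(z) x_j(w) = g_ij(w z⁻¹ q^{c'/2}) x_j(w) ψ_i(z)`, with `Q i j = q_ij`. -/
inductive Rel (Q : I → I → ℂ) : UNeg I → Prop where
  | qc_central (b : UNeg I) : Rel Q (qc * b - b * qc)
  | qcInv_central (b : UNeg I) : Rel Q (qcInv * b - b * qcInv)
  | qc_mul_qcInv : Rel Q (qc * qcInv - 1)
  | qcInv_mul_qc : Rel Q (qcInv * qc - 1)
  | psi_mul_psiInv (i : I) : Rel Q (psi i 0 * psiInv i - 1)
  | psiInv_mul_psi (i : I) : Rel Q (psiInv i * psi i 0 - 1)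
  | psi_comm (i j : I) (k l : ℕ) : Rel Q (psi i k * psi j l - psi j l * psi i k)
  | psi_x (i j : I) (k : ℕ) (m : ℤ) : Rel Q (psi i k * x j m
      - ∑ p ∈ Finset.HasAntidiagonal.antidiagonal k,
          gCoeff Q i j p.1 • (K (p.1 : ℤ) * x j (m + p.1) * psi i p.2))

end UNeg

/-! ## Weak Hopf pairings -/

section Pairing

variable {I : Type*}

/-- A weak Hopf pairing: the four axioms of a Hopf pairing, where the a priori infinite sums over
the words of `Δ₊(a)`, `Δ₋(b)`, `S⁻¹(a)`, `S(b)` have only finitely many nonzero summands. -/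
structure IsWeakHopfPairing (P : UPos I →ₗ[ℂ] UNeg I →ₗ[ℂ] ℂ) : Prop where
  finite_right : ∀ (a : UPos I) (b b' : UNeg I),
    {p : List (PosGen I) × List (PosGen I) |
      UPos.comul a p.1 p.2 * (P (mono p.1) b * P (mono p.2) b') ≠ 0}.Finite
  map_mul_right : ∀ (a : UPos I) (b b' : UNeg I),
    P a (b * b') = ∑ᶠ p : List (PosGen I) × List (PosGen I),
      UPos.comul a p.1 p.2 * (P (mono p.1) b * P (mono p.2) b')
  finite_left : ∀ (a a' : UPos I) (b : UNeg I),
    {p : List (NegGen I) × List (NegGen I) |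
      UNeg.comul b p.1 p.2 * (P a (mono p.2) * P a' (mono p.1)) ≠ 0}.Finite
  map_mul_left : ∀ (a a' : UPos I) (b : UNeg I),
    P (a * a') b = ∑ᶠ p : List (NegGen I) × List (NegGen I),
      UNeg.comul b p.1 p.2 * (P a (mono p.2) * P a' (mono p.1))
  map_one_right : ∀ a : UPos I, P a 1 = UPos.counit a
  map_one_left : ∀ b : UNeg I, P 1 b = UNeg.counit b
  finite_antipodeInv : ∀ (a : UPos I) (b : UNeg I),
    {u : List (PosGen I) | UPos.antipodeInv a u * P (mono u) b ≠ 0}.Finite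
  finite_antipode : ∀ (a : UPos I) (b : UNeg I),
    {v : List (NegGen I) | UNeg.antipode b v * P a (mono v) ≠ 0}.Finite
  map_antipode : ∀ (a : UPos I) (b : UNeg I),
    ∑ᶠ u : List (PosGen I), UPos.antipodeInv a u * P (mono u) b
      = ∑ᶠ v : List (NegGen I), UNeg.antipode b v * P a (mono v)

/-- Homogeneous elements pair to zero unless their degrees in the root lattice are opposite. -/
def IsQGraded [DecidableEq I] (P : UPos I →ₗ[ℂ] UNeg I →ₗ[ℂ] ℂ) : Prop :=
  ∀ α β : I → ℤ, α + β ≠ 0 →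
    ∀ a ∈ homogeneous UPos.deg α, ∀ b ∈ homogeneous UNeg.deg β, P a b = 0

/-- The prescribed values on generators, with `Q i j = q_ij`. Note that `UPos.phi i k` is
`φ_{i,-k}`. -/
structure HasPrescribedValues [DecidableEq I] (q : ℂ) (Q : I → I → ℂ)
    (P : UPos I →ₗ[ℂ] UNeg I →ₗ[ℂ] ℂ) : Prop where
  qc_qc : P UPos.qc UNeg.qc = 1
  qc_qcInv : P UPos.qc UNeg.qcInv = 1
  qcInv_qc : P UPos.qcInv UNeg.qc = 1
  qcInv_qcInv : P UPos.qcInv UNeg.qcInv = 1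
  qc_psi : ∀ i k, P UPos.qc (UNeg.psi i k) = if k = 0 then 1 else 0
  qcInv_psi : ∀ i k, P UPos.qcInv (UNeg.psi i k) = if k = 0 then 1 else 0
  phi_qc : ∀ i k, P (UPos.phi i k) UNeg.qc = if k = 0 then 1 else 0
  phi_qcInv : ∀ i k, P (UPos.phi i k) UNeg.qcInv = if k = 0 then 1 else 0
  qc_psiInv : ∀ i, P UPos.qc (UNeg.psiInv i) = 1
  qcInv_psiInv : ∀ i, P UPos.qcInv (UNeg.psiInv i) = 1
  phiInv_qc : ∀ i, P (UPos.phiInv i) UNeg.qc = 1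
  phiInv_qcInv : ∀ i, P (UPos.phiInv i) UNeg.qcInv = 1
  qc_x : ∀ i n, P UPos.qc (UNeg.x i n) = 0
  qcInv_x : ∀ i n, P UPos.qcInv (UNeg.x i n) = 0
  x_qc : ∀ i n, P (UPos.x i n) UNeg.qc = 0
  x_qcInv : ∀ i n, P (UPos.x i n) UNeg.qcInv = 0
  phi_x : ∀ i k j n, P (UPos.phi i k) (UNeg.x j n) = 0
  x_psi : ∀ j n i k, P (UPos.x j n) (UNeg.psi i k) = 0
  phi_psi : ∀ i j l k, P (UPos.phi i l) (UNeg.psi j k) = if k = l then gCoeff Q i j k else 0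
  phiInv_psi : ∀ i j, P (UPos.phiInv i) (UNeg.psi j 0) = (gCoeff Q i j 0)⁻¹
  phi_psiInv : ∀ i j, P (UPos.phi i 0) (UNeg.psiInv j) = (gCoeff Q i j 0)⁻¹
  x_x : ∀ i j n m, P (UPos.x i n) (UNeg.x j m)
    = if i = j ∧ n = -m then -1 / (q + q⁻¹) else 0

end Pairing

end QuantumAffine

end

/-!
Since `q^{±c/2}` and `q^{±c'/2}` are group-like and pair with the letters like the units, they pair
with everything like the units and drop out of the pairing. The bijection `UNeg.genEquiv` of the
letters (`x⁻_{i,n} ↦ x⁺_{i,-n}`, `ψ ↦ φ`, `q^{c'/2} ↦ q^{-c/2}`) carries `Δ₋` to the opposite of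
`Δ₊`, `S` to `S⁻¹` and the relations of the negative side to those of the positive side. So a pairing
of the two sides is the same as a bilinear form on the positive algebra, one axiom of a Hopf pairing
becomes the other one for the transposed form, and it suffices to find one *symmetric* form.

The form is `(a, b) ↦ ε(b · a)` (`UPos.form`), where `b · a` is a right action of the free algebra on
itself, the one which in a Hopf pairing is `∑ ⟨a, b₂⟩ b₁`. On letters it is forced by the prescribed
values, and it is extended to products through `Δ₊`: the series `φ_i(z)` acts by an algebra
homomorphism to power series (`UPos.phiAct`), and `x_i(z)` by a twisted derivation, which is the
off-diagonal entry of a homomorphism to upper triangular matrices of Laurent series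
(`UPos.triAct`). Hence the product rule in the right argument holds by construction
(`UPos.form_mul_right_eq_finsum`); the sums are finite because `b · x_{i,n} = 0` for large `n`.

* Symmetry. The action of a letter `h` on a product `h' b` is given by a formula
  (`UPos.act_ι_mul`) which is symmetric in `h` and `h'`. By induction `(a, h b) = (a · h, b)`
  (`UPos.form_ι_mul_right`), and `UPos.form_comm` follows.
* Antipode. The action of `S⁻¹(h)` on `b` is, up to reversing the words, the action of `h` for the
  parameters `1 / g` and `-c` instead of `g` and `c`, where `c` is the value
  of `⟨x⁺_{i,n}, x⁻_{i,-n}⟩` (`UPos.finsum_antipodeInvGen`). So `(S⁻¹(a), b)` is, on the reversed words,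
  the form for these parameters (`UPos.form_antipodeInv`), and that is symmetric as well.
* Radical. The relations among the `φ` hold for the operators, and the elements expressing the
  exchange of `φ_i(z)` and `x_j(w)` are killed by `ε` and, up to the central letters, span a
  subspace stable under all letters (`UPos.form_crossRel`).
* Uniqueness. The grading and the antipode axiom give the few values on pairs of letters that are
  not prescribed, such as `⟨φ_{i,0}⁻¹, ψ_{j,k}⟩` (`pairing_ι_ι_unique`); the two product rules then
  give all others (`pairing_unique`).
-/

noncomputable section

namespace QuantumAffine


/-! ### Words and finite sums -/

section Words

variable {G : Type*}

theorem mono_nil : mono ([] : List G) = 1 := rfl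

theorem mono_cons (g : G) (w : List G) : mono (g :: w) = FreeAlgebra.ι ℂ g * mono w := rfl

theorem mono_append (u v : List G) : mono (u ++ v) = mono u * mono v := by
  simp [mono]

theorem mono_singleton (g : G) : mono [g] = FreeAlgebra.ι ℂ g := by
  simp [mono]

theorem basisFreeMonoid_ofList (w : List G) :
    FreeAlgebra.basisFreeMonoid ℂ G (FreeMonoid.ofList w) = mono w := by
  have h : FreeAlgebra.basisFreeMonoid ℂ G (FreeMonoid.ofList w)
      = FreeAlgebra.equivMonoidAlgebraFreeMonoid.symm
          (MonoidAlgebra.of ℂ (FreeMonoid G) (FreeMonoid.ofList w)) := rfl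
  rw [h]
  simp [FreeAlgebra.equivMonoidAlgebraFreeMonoid, mono, FreeMonoid.lift_apply]

theorem repr_mono (w : List G) :
    (FreeAlgebra.basisFreeMonoid ℂ G).repr (mono w) = Finsupp.single (FreeMonoid.ofList w) 1 := by
  rw [← basisFreeMonoid_ofList, Module.Basis.repr_self]

open Classical in
theorem coeff_mono (w u : List G) : coeff (mono w) u = if u = w then 1 else 0 := by
  rw [coeff, repr_mono, Finsupp.single_apply]
  simp [eq_comm]

theorem coeff_add (a b : FreeAlgebra ℂ G) (u : List G) : coeff (a + b) u = coeff a u + coeff b u := by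
  simp [coeff]

theorem coeff_smul (r : ℂ) (a : FreeAlgebra ℂ G) (u : List G) :
    coeff (r • a) u = r * coeff a u := by
  simp [coeff]

theorem coeff_support_finite (a : FreeAlgebra ℂ G) : {u : List G | coeff a u ≠ 0}.Finite :=
  ((FreeAlgebra.basisFreeMonoid ℂ G).repr a).hasFiniteSupport.subset fun _ hu => hu

theorem mono_induction {p : FreeAlgebra ℂ G → Prop} (mono : ∀ w, p (mono w))
    (add : ∀ a b, p a → p b → p (a + b)) (smul : ∀ (r : ℂ) a, p a → p (r • a))
    (a : FreeAlgebra ℂ G) : p a := by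
  have ha : a ∈ Submodule.span ℂ (Set.range (FreeAlgebra.basisFreeMonoid ℂ G)) := by
    rw [(FreeAlgebra.basisFreeMonoid ℂ G).span_eq]; trivial
  induction ha using Submodule.span_induction with
  | mem x hx =>
    obtain ⟨w, rfl⟩ := hx
    have := mono (FreeMonoid.toList w)
    rwa [← basisFreeMonoid_ofList] at this
  | zero => simpa using smul 0 _ (mono [])
  | add x y _ _ hx hy => exact add x y hx hy
  | smul r x _ hx => exact smul r x hx

theorem linearMap_ext_mono {V : Type*} [AddCommMonoid V] [Module ℂ V]
    {f f' : FreeAlgebra ℂ G →ₗ[ℂ] V} (h : ∀ w, f (mono w) = f' (mono w)) : f = f' := by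
  ext a
  induction a using mono_induction with
  | mono w => exact h w
  | add a b ha hb => rw [map_add, map_add, ha, hb]
  | smul r a ha => rw [map_smul, map_smul, ha]

theorem comulExt_mono (D : G → List G → List G → ℂ) (w u v : List G) :
    comulExt D (mono w) u v = comulWord D w u v := by
  rw [comulExt, repr_mono, Finsupp.sum_single_index (by simp)]
  simp

theorem comulExt_add (D : G → List G → List G → ℂ) (a b : FreeAlgebra ℂ G) (u v : List G) :
    comulExt D (a + b) u v = comulExt D a u v + comulExt D b u v := by
  rw [comulExt, map_add, Finsupp.sum_add_index' (by simp) (by intros; ring)]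
  rfl

theorem comulExt_smul (D : G → List G → List G → ℂ) (r : ℂ) (a : FreeAlgebra ℂ G)
    (u v : List G) : comulExt D (r • a) u v = r * comulExt D a u v := by
  rw [comulExt, map_smul, Finsupp.sum_smul_index (by simp), comulExt, Finsupp.mul_sum]
  simp [mul_assoc]

theorem antiExt_mono (T : G → List G → ℂ) (w u : List G) :
    antiExt T (mono w) u = antiWord T w u := by
  rw [antiExt, repr_mono, Finsupp.sum_single_index (by simp)]
  simp

theorem antiExt_add (T : G → List G → ℂ) (a b : FreeAlgebra ℂ G) (u : List G) :
    antiExt T (a + b) u = antiExt T a u + antiExt T b u := by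
  rw [antiExt, map_add, Finsupp.sum_add_index' (by simp) (by intros; ring)]
  rfl

theorem antiExt_smul (T : G → List G → ℂ) (r : ℂ) (a : FreeAlgebra ℂ G) (u : List G) :
    antiExt T (r • a) u = r * antiExt T a u := by
  rw [antiExt, map_smul, Finsupp.sum_smul_index (by simp), antiExt, Finsupp.mul_sum]
  simp [mul_assoc]

/-- Summation over the fibres of `π`, each of which is a finite set. -/
theorem finsum_fiberwise {α β M : Type*} [AddCommMonoid M] (π : α → β) (fib : β → Finset α)
    (hfib : ∀ x y, x ∈ fib y ↔ π x = y) (H : α → M) (hH : (Function.support H).Finite) :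
    (Function.support fun y => ∑ x ∈ fib y, H x).Finite ∧
      ∑ᶠ y, ∑ x ∈ fib y, H x = ∑ᶠ x, H x := by
  classical
  have hsub : (Function.support fun y => ∑ x ∈ fib y, H x) ⊆ hH.toFinset.image π := by
    intro y hy
    obtain ⟨x, hx, hx0⟩ := Finset.exists_ne_zero_of_sum_ne_zero hy
    simp only [Finset.coe_image, Set.mem_image, Finset.mem_coe, Set.Finite.mem_toFinset]
    exact ⟨x, hx0, (hfib x y).1 hx⟩
  refine ⟨(Finset.finite_toSet _).subset hsub, ?_⟩
  rw [finsum_eq_sum_of_support_subset _ hsub,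
    finsum_eq_sum_of_support_subset H (s := hH.toFinset) (by simp),
    ← Finset.sum_fiberwise_of_maps_to (g := π) (t := hH.toFinset.image π)
      (fun x hx => Finset.mem_image_of_mem _ hx)]
  refine Finset.sum_congr rfl fun y _ => ?_
  symm
  refine Finset.sum_subset_zero_on_sdiff (fun x hx => ?_) (fun x hx => ?_) (fun _ _ => rfl)
  · exact (hfib x y).2 (Finset.mem_filter.1 hx).2
  · simp only [Finset.mem_sdiff, Finset.mem_filter, Set.Finite.mem_toFinset, not_and] at hx
    by_contra h0
    exact hx.2 h0 ((hfib x y).1 hx.1)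

open Classical in
/-- The factorizations of a word into two words. -/
def splits (u : List G) : Finset (List G × List G) :=
  (Finset.range (u.length + 1)).image fun i => (u.take i, u.drop i)

theorem mem_splits (x : List G × List G) (u : List G) : x ∈ splits u ↔ x.1 ++ x.2 = u := by
  simp only [splits, Finset.mem_image, Finset.mem_range]
  constructor
  · rintro ⟨i, _, rfl⟩
    exact List.take_append_drop i u
  · rintro rfl
    exact ⟨x.1.length, by simp, by simp⟩

theorem sum_splits {M : Type*} [AddCommMonoid M] (u : List G) (f : List G × List G → M) :
    ∑ x ∈ splits u, f x = ∑ i ∈ Finset.range (u.length + 1), f (u.take i, u.drop i) := by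
  classical
  rw [splits, Finset.sum_image]
  intro i hi j hj hij
  simp only [Finset.coe_range, Set.mem_Iio] at hi hj
  have := congrArg (fun x : List G × List G => x.1.length) hij
  simp only [List.length_take] at this
  omega

variable {V : Type*} [AddCommGroup V] [Module ℂ V]

theorem finsum_coeff_smul (f : FreeAlgebra ℂ G →ₗ[ℂ] V) (a : FreeAlgebra ℂ G) :
    ∑ᶠ u : List G, coeff a u • f (mono u) = f a := by
  induction a using mono_induction with
  | mono w =>
    rw [finsum_eq_single _ w]
    · simp [coeff_mono]
    · intro u hu
      simp [coeff_mono, hu]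
  | add a a' ha ha' =>
    simp only [coeff_add, add_smul]
    rw [finsum_add_distrib, ha, ha', map_add]
    · exact (coeff_support_finite a).subset fun u hu => left_ne_zero_of_smul hu
    · exact (coeff_support_finite a').subset fun u hu => left_ne_zero_of_smul hu
  | smul r a ha =>
    simp only [coeff_smul, mul_smul]
    rw [← smul_finsum, ha, map_smul]

/-- A sum over the words of a product of two formal series is a double sum. -/
theorem finsum_splits_smul (S T : List G → ℂ) (f : List G → V)
    (hfin : {x : List G × List G | S x.1 * T x.2 ≠ 0 ∧ f (x.1 ++ x.2) ≠ 0}.Finite) :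
    {u : List G | (∑ i ∈ Finset.range (u.length + 1), S (u.take i) * T (u.drop i)) • f u
        ≠ 0}.Finite ∧
      ∑ᶠ u : List G, (∑ i ∈ Finset.range (u.length + 1), S (u.take i) * T (u.drop i)) • f u
        = ∑ᶠ x : List G × List G, (S x.1 * T x.2) • f (x.1 ++ x.2) := by
  have := finsum_fiberwise (fun x : List G × List G => x.1 ++ x.2) splits mem_splits
    (fun x => (S x.1 * T x.2) • f (x.1 ++ x.2))
    (hfin.subset fun x hx => ⟨left_ne_zero_of_smul hx, right_ne_zero_of_smul hx⟩)
  simpa only [sum_splits, List.take_append_drop, Finset.sum_smul, Function.support] using this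

/-- A sum over the pairs of words in a product of two formal series is a double sum. -/
theorem finsum_comulWord_cons (D : G → List G → List G → ℂ) (g : G) (w : List G)
    (f : List G → List G → V)
    (hfin : {x : (List G × List G) × (List G × List G) | D g x.1.1 x.1.2 ≠ 0 ∧
      comulWord D w x.2.1 x.2.2 ≠ 0 ∧ f (x.1.1 ++ x.2.1) (x.1.2 ++ x.2.2) ≠ 0}.Finite) :
      {p : List G × List G | comulWord D (g :: w) p.1 p.2 • f p.1 p.2 ≠ 0}.Finite ∧
      ∑ᶠ p : List G × List G, comulWord D (g :: w) p.1 p.2 • f p.1 p.2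
        = ∑ᶠ x : (List G × List G) × (List G × List G),
          (D g x.1.1 x.1.2 * comulWord D w x.2.1 x.2.2) •
            f (x.1.1 ++ x.2.1) (x.1.2 ++ x.2.2) := by
  have key := finsum_fiberwise
    (fun x : (List G × List G) × (List G × List G) => (x.1.1 ++ x.2.1, x.1.2 ++ x.2.2))
    (fun y => (splits y.1 ×ˢ splits y.2).map (Equiv.prodProdProdComm _ _ _ _).toEmbedding)
    (fun x y => by
      rw [Finset.mem_map_equiv]
      simp [mem_splits, Prod.ext_iff])
    (fun x => (D g x.1.1 x.1.2 * comulWord D w x.2.1 x.2.2) •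
            f (x.1.1 ++ x.2.1) (x.1.2 ++ x.2.2))
    (hfin.subset fun x hx => ⟨left_ne_zero_of_mul (left_ne_zero_of_smul hx),
      right_ne_zero_of_mul (left_ne_zero_of_smul hx), right_ne_zero_of_smul hx⟩)
  simpa only [Finset.sum_map, Finset.sum_product, sum_splits, Equiv.coe_toEmbedding,
    Equiv.prodProdProdComm_apply, List.take_append_drop, comulWord, Finset.sum_smul,
    Function.support] using key

end Words

/-! ### Right actions of a free algebra -/

section Action

variable {G V : Type*} [AddCommGroup V] [Module ℂ V]

/-- The right action of the free algebra on `V` in which the letters act by `act`;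
`rightAct act a b` is `b · a`. -/
def rightAct (act : G → Module.End ℂ V) : FreeAlgebra ℂ G →ₗ[ℂ] Module.End ℂ V :=
  (MulOpposite.opLinearEquiv ℂ).symm.toLinearMap ∘ₗ
    (FreeAlgebra.lift ℂ fun g => MulOpposite.op (act g)).toLinearMap

variable (act : G → Module.End ℂ V)

@[simp] theorem rightAct_one (b : V) : rightAct act 1 b = b := by
  simp [rightAct]

theorem rightAct_mul (a a' : FreeAlgebra ℂ G) (b : V) :
    rightAct act (a * a') b = rightAct act a' (rightAct act a b) := by
  simp [rightAct]

@[simp] theorem rightAct_ι (g : G) : rightAct act (FreeAlgebra.ι ℂ g) = act g := by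
  simp [rightAct]

theorem rightAct_mono_append (u v : List G) (b : V) :
    rightAct act (mono (u ++ v)) b = rightAct act (mono v) (rightAct act (mono u) b) := by
  rw [mono_append, rightAct_mul]

theorem rightAct_mono_cons (g : G) (w : List G) (b : V) :
    rightAct act (mono (g :: w)) b = rightAct act (mono w) (act g b) := by
  rw [mono_cons, rightAct_mul, rightAct_ι]

/-- If the anti-multiplicative map given on letters by `T` acts on `V`, on letters, by the
operators `R`, then it acts on words by the products of these operators. -/
theorem finsum_antiWord {T : G → List G → ℂ} {R : G → Module.End ℂ V}
    (hfin : ∀ g b, {u : List G | T g u ≠ 0 ∧ rightAct act (mono u) b ≠ 0}.Finite)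
    (hsum : ∀ g b, R g b = ∑ᶠ u : List G, T g u • rightAct act (mono u) b)
    (w : List G) (b : V) :
    {u : List G | antiWord T w u ≠ 0 ∧ rightAct act (mono u) b ≠ 0}.Finite ∧
      ∑ᶠ u : List G, antiWord T w u • rightAct act (mono u) b = (w.map R).prod b := by
  induction w with
  | nil =>
    have h : ∀ u : List G, antiWord T [] u = coeff (1 : FreeAlgebra ℂ G) u := fun u => rfl
    simp only [h]
    refine ⟨(coeff_support_finite 1).subset fun u hu => hu.1, ?_⟩
    simpa using finsum_coeff_smul ((rightAct act).flip b) 1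
  | cons g w ih =>
    have hT : {x : List G × List G | antiWord T w x.1 * T g x.2 ≠ 0 ∧
        rightAct act (mono (x.1 ++ x.2)) b ≠ 0}.Finite := by
      refine (ih.1.biUnion fun u _ =>
        (hfin g (rightAct act (mono u) b)).image (Prod.mk u)).subset ?_
      rintro ⟨u, v⟩ ⟨h1, h2⟩
      simp only [rightAct_mono_append] at h2
      refine Set.mem_biUnion (x := u) ⟨left_ne_zero_of_mul h1, fun h0 => ?_⟩
        ⟨v, ⟨right_ne_zero_of_mul h1, h2⟩, rfl⟩
      exact h2 (by rw [h0, map_zero])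
    have key := finsum_splits_smul (antiWord T w) (T g) (fun u => rightAct act (mono u) b) hT
    have hfin' : {u : List G | antiWord T (g :: w) u ≠ 0 ∧
        rightAct act (mono u) b ≠ 0}.Finite :=
      key.1.subset fun u hu => smul_ne_zero hu.1 hu.2
    refine ⟨hfin', key.2.trans ?_⟩
    rw [finsum_curry]
    · simp only [rightAct_mono_append, mul_smul]
      simp only [← smul_finsum, ← hsum]
      rw [List.map_cons, List.prod_cons, Module.End.mul_apply, ← ih.2, map_finsum]
      · simp only [map_smul]
      · exact ih.1.subset fun u hu => ⟨left_ne_zero_of_smul hu, right_ne_zero_of_smul hu⟩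
    · exact hT.subset fun x hx => ⟨left_ne_zero_of_smul hx, right_ne_zero_of_smul hx⟩

end Action

section ProductRule

variable {G V : Type*} [Ring V] [Algebra ℂ V] (act : G → Module.End ℂ V)

/-- If the letters act on products in `V` through the coproduct `D`, then so do all elements of
the free algebra, through the multiplicative extension of `D`. -/
theorem rightAct_map_mul {D : G → List G → List G → ℂ}
    (hfin : ∀ g b b', {p : List G × List G | D g p.1 p.2 ≠ 0 ∧
      rightAct act (mono p.1) b ≠ 0 ∧ rightAct act (mono p.2) b' ≠ 0}.Finite)
    (hsum : ∀ g b b', act g (b * b') = ∑ᶠ p : List G × List G, D g p.1 p.2 •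
      (rightAct act (mono p.1) b * rightAct act (mono p.2) b'))
    (a : FreeAlgebra ℂ G) (b b' : V) :
    {p : List G × List G | comulExt D a p.1 p.2 ≠ 0 ∧
      rightAct act (mono p.1) b ≠ 0 ∧ rightAct act (mono p.2) b' ≠ 0}.Finite ∧
    rightAct act a (b * b') = ∑ᶠ p : List G × List G, comulExt D a p.1 p.2 •
      (rightAct act (mono p.1) b * rightAct act (mono p.2) b') := by
  have hsupp : ∀ (a : FreeAlgebra ℂ G), {p : List G × List G | comulExt D a p.1 p.2 ≠ 0 ∧
      rightAct act (mono p.1) b ≠ 0 ∧ rightAct act (mono p.2) b' ≠ 0}.Finite →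
      (Function.support fun p : List G × List G => comulExt D a p.1 p.2 •
      (rightAct act (mono p.1) b * rightAct act (mono p.2) b')).Finite := fun a h =>
    h.subset fun p hp => ⟨left_ne_zero_of_smul hp,
      left_ne_zero_of_mul (right_ne_zero_of_smul hp),
      right_ne_zero_of_mul (right_ne_zero_of_smul hp)⟩
  induction a using mono_induction with
  | mono w =>
    clear hsupp
    simp only [comulExt_mono]
    induction w generalizing b b' with
    | nil =>
      have h : ∀ u v : List G, comulWord D [] u v = tmul 1 1 u v := fun u v => rfl
      have h1 : ∀ u : List G, coeff (1 : FreeAlgebra ℂ G) u ≠ 0 → u = [] := by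
        intro u hu
        rw [← mono_nil, coeff_mono] at hu
        by_contra h'
        simp [h'] at hu
      have h2 : ∀ p : List G × List G, tmul (1 : FreeAlgebra ℂ G) 1 p.1 p.2 ≠ 0 → p = ([], []) :=
        fun p hp => Prod.ext (h1 _ (left_ne_zero_of_mul hp)) (h1 _ (right_ne_zero_of_mul hp))
      simp only [h]
      refine ⟨(Set.finite_singleton ([], [])).subset fun p hp => h2 p hp.1, ?_⟩
      rw [finsum_eq_single _ ([], [])]
      · rw [tmul, ← mono_nil, coeff_mono]
        simp [mono_nil]
      · intro p hp
        have : tmul (1 : FreeAlgebra ℂ G) 1 p.1 p.2 = 0 := by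
          by_contra h'
          exact hp (h2 p h')
        rw [this, zero_smul]
    | cons g w ih =>
      have hT : {x : (List G × List G) × (List G × List G) | D g x.1.1 x.1.2 ≠ 0 ∧
          comulWord D w x.2.1 x.2.2 ≠ 0 ∧ rightAct act (mono (x.1.1 ++ x.2.1)) b ≠ 0 ∧
          rightAct act (mono (x.1.2 ++ x.2.2)) b' ≠ 0}.Finite := by
        refine ((hfin g b b').biUnion fun p _ =>
          (ih (rightAct act (mono p.1) b) (rightAct act (mono p.2) b')).1.image
            (Prod.mk p)).subset ?_
        rintro ⟨p, p'⟩ ⟨h1, h2, h3, h4⟩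
        simp only [rightAct_mono_append] at h3 h4
        exact Set.mem_biUnion (x := p) ⟨h1, fun h0 => h3 (by rw [h0, map_zero]),
          fun h0 => h4 (by rw [h0, map_zero])⟩ ⟨p', ⟨h2, h3, h4⟩, rfl⟩
      have key := finsum_comulWord_cons D g w
        (fun u v => rightAct act (mono u) b * rightAct act (mono v) b')
        (hT.subset fun x hx => ⟨hx.1, hx.2.1, left_ne_zero_of_mul hx.2.2,
          right_ne_zero_of_mul hx.2.2⟩)
      have hfin' : {p : List G × List G | comulWord D (g :: w) p.1 p.2 ≠ 0 ∧
          rightAct act (mono p.1) b ≠ 0 ∧ rightAct act (mono p.2) b' ≠ 0}.Finite := by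
        refine (hT.image fun x => (x.1.1 ++ x.2.1, x.1.2 ++ x.2.2)).subset ?_
        rintro ⟨u, v⟩ ⟨h1, h2, h3⟩
        rw [comulWord] at h1
        obtain ⟨i, _, h1⟩ := Finset.exists_ne_zero_of_sum_ne_zero h1
        obtain ⟨j, _, h1⟩ := Finset.exists_ne_zero_of_sum_ne_zero h1
        refine ⟨((u.take i, v.take j), (u.drop i, v.drop j)), ⟨left_ne_zero_of_mul h1,
          right_ne_zero_of_mul h1, ?_, ?_⟩, ?_⟩ <;> simp [h2, h3]
      refine ⟨hfin', ?_⟩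
      have hc := finsum_curry (fun x : (List G × List G) × (List G × List G) =>
          (D g x.1.1 x.1.2 * comulWord D w x.2.1 x.2.2) •
            (rightAct act (mono (x.1.1 ++ x.2.1)) b * rightAct act (mono (x.1.2 ++ x.2.2)) b'))
        (hT.subset fun x hx => ⟨left_ne_zero_of_mul (left_ne_zero_of_smul hx),
          right_ne_zero_of_mul (left_ne_zero_of_smul hx),
          left_ne_zero_of_mul (right_ne_zero_of_smul hx),
          right_ne_zero_of_mul (right_ne_zero_of_smul hx)⟩)
      rw [key.2, hc, rightAct_mono_cons, hsum, map_finsum]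
      · refine finsum_congr fun p => ?_
        rw [map_smul, (ih _ _).2, smul_finsum]
        refine finsum_congr fun p' => ?_
        rw [rightAct_mono_append, rightAct_mono_append, mul_smul]
      · exact (hfin g b b').subset fun p hp => ⟨left_ne_zero_of_smul hp,
          left_ne_zero_of_mul (right_ne_zero_of_smul hp),
          right_ne_zero_of_mul (right_ne_zero_of_smul hp)⟩
  | add a a' ha ha' =>
    refine ⟨(ha.1.union ha'.1).subset ?_, ?_⟩
    · rintro p ⟨h1, h2⟩
      by_cases h0 : comulExt D a p.1 p.2 = 0
      · exact Or.inr ⟨fun h => h1 (by rw [comulExt_add, h0, h, add_zero]), h2⟩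
      · exact Or.inl ⟨h0, h2⟩
    · rw [map_add, LinearMap.add_apply, ha.2, ha'.2, ← finsum_add_distrib]
      · simp only [comulExt_add, add_smul]
      · exact hsupp a ha.1
      · exact hsupp a' ha'.1
  | smul r a ha =>
    refine ⟨ha.1.subset fun p hp => ⟨fun h => hp.1 (by rw [comulExt_smul, h, mul_zero]), hp.2⟩, ?_⟩
    rw [map_smul, LinearMap.smul_apply, ha.2, smul_finsum]
    simp only [comulExt_smul, mul_smul]

end ProductRule


/-! ### The letter operators -/

/-- A coefficient of the product of a power series and a Laurent series; the cutoff `N` only has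
to be large enough. -/
theorem coeff_ofPowerSeries_mul {R : Type*} [Ring R] (f : PowerSeries R) (L : HahnSeries ℤ R)
    (n : ℤ) (N : ℕ) (hN : ∀ k : ℕ, N ≤ k → L.coeff (n - k) = 0) :
    (HahnSeries.ofPowerSeries ℤ R f * L).coeff n
      = ∑ k ∈ Finset.range N, PowerSeries.coeff k f * L.coeff (n - k) := by
  have hsupp : ∀ i : ℤ, (HahnSeries.ofPowerSeries ℤ R f).coeff i ≠ 0 → ∃ k : ℕ, (k : ℤ) = i := by
    intro i hi
    by_contra hk
    refine hi ?_
    rw [HahnSeries.ofPowerSeries_apply]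
    exact HahnSeries.embDomain_of_notMem_range fun ⟨k, hk'⟩ => hk ⟨k, by simpa using hk'⟩
  rw [HahnSeries.coeff_mul]
  refine Finset.sum_of_injOn (fun ij => ij.1.toNat) ?_ ?_ ?_ ?_
  · rintro ⟨i, j⟩ h ⟨i', j'⟩ h' hij
    rw [Finset.mem_coe, Finset.mem_antidiagonal] at h h'
    obtain ⟨k, hk⟩ := hsupp i h.1
    obtain ⟨k', hk'⟩ := hsupp i' h'.1
    have h1 := h.2.2
    have h2 := h'.2.2
    simp only at hij h1 h2 hk hk'
    rw [Prod.mk.injEq]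
    omega
  · rintro ⟨i, j⟩ h
    rw [Finset.mem_coe, Finset.mem_antidiagonal] at h
    obtain ⟨k, rfl⟩ := hsupp i h.1
    simp only [Int.toNat_natCast, Finset.coe_range, Set.mem_Iio]
    by_contra hk
    refine h.2.1 ?_
    have h1 : j = n - k := by have := h.2.2; simp only at this; omega
    simp only [h1]
    exact hN k (by omega)
  · intro k _ hk
    by_contra h0
    refine hk ⟨((k : ℤ), n - k), ?_, by simp⟩
    rw [Finset.mem_coe, Finset.mem_antidiagonal]
    refine ⟨?_, right_ne_zero_of_mul h0, by simp⟩
    rw [HahnSeries.mem_support, HahnSeries.ofPowerSeries_apply_coeff]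
    exact left_ne_zero_of_mul h0
  · rintro ⟨i, j⟩ h
    rw [Finset.mem_antidiagonal] at h
    obtain ⟨k, rfl⟩ := hsupp i h.1
    have h1 : j = n - k := by have := h.2.2; simp only at this; omega
    rw [HahnSeries.ofPowerSeries_apply_coeff]
    simp [h1]

namespace UPos

variable {I : Type*}

/-- The letter with its mode shifted by `k`; it is `0` when there is no such letter. For the
generating series of the letters this is multiplication by `z ^ k`. -/
def shift (k : ℕ) : PosGen I → UPos I
  | .x i n => x i (n + k)
  | .phi i l => if k ≤ l then phi i (l - k) else 0
  | .phiInv i => if k = 0 then phiInv i else 0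
  | .qc => if k = 0 then qc else 0
  | .qcInv => if k = 0 then qcInv else 0

/-- The series `r(z)` such that the generating series of the letters `h` and `h'` braid with the
factor `r`: it is `g_ij` between `x_i`, `φ_i` and `x_j`, `φ_j`, inverted once for each
`φ_{i,0}⁻¹`, for which only the constant term matters. -/
def pairSeries (g : I → I → PowerSeries ℂ) : PosGen I → PosGen I → PowerSeries ℂ
  | .qc, _ => 1
  | .qcInv, _ => 1
  | _, .qc => 1
  | _, .qcInv => 1
  | .phiInv i, .phiInv j => PowerSeries.C (PowerSeries.coeff 0 (g i j))
  | .phiInv i, .x j _ => PowerSeries.C (PowerSeries.coeff 0 (g i j))⁻¹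
  | .phiInv i, .phi j _ => PowerSeries.C (PowerSeries.coeff 0 (g i j))⁻¹
  | .x i _, .phiInv j => PowerSeries.C (PowerSeries.coeff 0 (g i j))⁻¹
  | .phi i _, .phiInv j => PowerSeries.C (PowerSeries.coeff 0 (g i j))⁻¹
  | .x i _, .x j _ => g i j
  | .x i _, .phi j _ => g i j
  | .phi i _, .x j _ => g i j
  | .phi i _, .phi j _ => g i j

/-- The coefficients of `pairSeries`. -/
def pairCoeff (g : I → I → PowerSeries ℂ) (h h' : PosGen I) (k : ℕ) : ℂ :=
  PowerSeries.coeff k (pairSeries g h h')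

variable (g : I → I → PowerSeries ℂ)

theorem pairCoeff_comm (hg : ∀ i j, g i j = g j i) (h h' : PosGen I) (k : ℕ) :
    pairCoeff g h h' k = pairCoeff g h' h k := by
  cases h <;> cases h' <;> simp only [pairCoeff, pairSeries] <;> rw [hg]

theorem shift_zero (h : PosGen I) : shift 0 h = FreeAlgebra.ι ℂ h := by
  cases h <;> simp [shift, x, phi, phiInv, qc, qcInv]

theorem shift_eq_zero_or (k : ℕ) (h : PosGen I) :
    shift k h = 0 ∨ ∃ h', shift k h = FreeAlgebra.ι ℂ h' := by
  cases h <;> simp only [shift, x, phi, phiInv, qc, qcInv]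
  · exact Or.inr ⟨_, rfl⟩
  all_goals
    split_ifs
    · exact Or.inr ⟨_, rfl⟩
    · exact Or.inl rfl

/-- The action of the series `φ_i(z)`. -/
def phiAct (i : I) : UPos I →ₐ[ℂ] PowerSeries (UPos I) :=
  FreeAlgebra.lift ℂ fun h => PowerSeries.mk fun k => pairCoeff g (.phi i 0) h k • shift k h

/-- The action of `φ_{i,0}⁻¹`. -/
def phiInvAct (i : I) : UPos I →ₐ[ℂ] UPos I :=
  FreeAlgebra.lift ℂ fun h => pairCoeff g (.phiInv i) h 0 • FreeAlgebra.ι ℂ h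

theorem coeff_phiAct_ι (i : I) (k : ℕ) (h : PosGen I) :
    PowerSeries.coeff k (phiAct g i (FreeAlgebra.ι ℂ h))
      = pairCoeff g (.phi i 0) h k • shift k h := by
  simp [phiAct]

variable [DecidableEq I] (c : ℂ)

/-- The pairing of two letters `x_{i,n}`. -/
def contract : PosGen I → PosGen I → ℂ
  | .x i n, .x j m => if i = j ∧ n = m then c else 0
  | _, _ => 0

theorem contract_comm (h h' : PosGen I) : contract c h h' = contract c h' h := by
  cases h <;> cases h' <;> simp only [contract]
  simp only [eq_comm]

/-- The value on a letter of the series `∑ X_n w ^ n`, where `X_n` is the action of `x_{i,-n}`. -/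
def xSeries (i : I) : PosGen I → HahnSeries ℤ (UPos I)
  | .x j m => if i = j then HahnSeries.single (-m) (algebraMap ℂ (UPos I) c) else 0
  | _ => 0

/-- The joint action of `x_i`, `φ_i` and the unit on products, which comes from the coproduct
`x_i ↦ x_i ⊗ 1 + φ_i ⊗ x_i`, as a homomorphism to upper triangular matrices. -/
def triAct (i : I) : UPos I →ₐ[ℂ] Matrix (Fin 2) (Fin 2) (HahnSeries ℤ (UPos I)) :=
  FreeAlgebra.lift ℂ fun h =>
    !![HahnSeries.ofPowerSeries ℤ _ (phiAct g i (FreeAlgebra.ι ℂ h)), xSeries c i h;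
      0, HahnSeries.C (FreeAlgebra.ι ℂ h)]

theorem triAct_entries (i : I) (b : UPos I) :
    triAct g c i b 1 0 = 0 ∧
      triAct g c i b 0 0 = HahnSeries.ofPowerSeries ℤ _ (phiAct g i b) ∧
      triAct g c i b 1 1 = HahnSeries.C b := by
  induction b using mono_induction with
  | mono w =>
    induction w with
    | nil => simp [mono_nil]
    | cons h w ih =>
      obtain ⟨h1, h2, h3⟩ := ih
      rw [mono_cons, map_mul]
      simp only [Matrix.mul_apply, Fin.sum_univ_two, h1, h2, h3, map_mul]
      simp [triAct]
  | add a b ha hb => simp [ha, hb]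
  | smul r a ha =>
    simp only [map_smul, Matrix.smul_apply, ha, smul_zero, true_and]
    constructor
    · exact (map_smul (HahnSeries.ofPowerSeriesAlg ℤ ℂ) r (phiAct g i a)).symm
    · ext n
      simp [HahnSeries.C_apply, HahnSeries.coeff_single]

/-- The action of `x_{i,n}`. -/
def xAct (i : I) (n : ℤ) : Module.End ℂ (UPos I) where
  toFun b := (triAct g c i b 0 1).coeff (-n)
  map_add' a b := by simp
  map_smul' r a := by simp

theorem xAct_one (i : I) (n : ℤ) : xAct g c i n 1 = 0 := by
  simp [xAct]

theorem xAct_eventually (i : I) (b : UPos I) : ∃ M : ℤ, ∀ n, M ≤ n → xAct g c i n b = 0 := by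
  refine ⟨-(triAct g c i b 0 1).order + 1, fun n hn => ?_⟩
  exact HahnSeries.coeff_eq_zero_of_lt_order (by omega)

theorem xAct_mul (i : I) (n : ℤ) (b b' : UPos I) (N : ℕ)
    (hN : ∀ k : ℕ, N ≤ k → xAct g c i (n + k) b' = 0) :
    xAct g c i n (b * b') = xAct g c i n b * b'
      + ∑ k ∈ Finset.range N, PowerSeries.coeff k (phiAct g i b) * xAct g c i (n + k) b' := by
  have h : ∀ k : ℕ, -(n + k) = -n - k := fun k => by ring
  simp only [xAct, LinearMap.coe_mk, AddHom.coe_mk, h] at hN ⊢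
  rw [map_mul, Matrix.mul_apply, Fin.sum_univ_two, (triAct_entries g c i b).2.1,
    (triAct_entries g c i b').2.2, HahnSeries.coeff_add, coeff_ofPowerSeries_mul _ _ _ N hN,
    HahnSeries.C_apply, HahnSeries.coeff_mul_single, sub_zero, add_comm]

theorem xAct_ι (i : I) (n : ℤ) (h : PosGen I) :
    xAct g c i n (FreeAlgebra.ι ℂ h) = algebraMap ℂ _ (contract c (.x i n) h) := by
  simp only [xAct, triAct, LinearMap.coe_mk, AddHom.coe_mk, FreeAlgebra.lift_ι_apply]
  cases h with
  | x j m =>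
    by_cases hij : i = j
    · by_cases hnm : n = m
      · simp [xSeries, contract, hij, hnm]
      · simp [xSeries, contract, hij, hnm]
    · simp [xSeries, contract, hij]
  | _ => simp [xSeries, contract]

/-- The action of the letters: `act g c h b` is `b · h`. -/
def act : PosGen I → Module.End ℂ (UPos I)
  | .x i n => xAct g c i n
  | .phi i k => (PowerSeries.coeff (R := UPos I) k).restrictScalars ℂ ∘ₗ (phiAct g i).toLinearMap
  | .phiInv i => (phiInvAct g i).toLinearMap
  | .qc => LinearMap.id
  | .qcInv => LinearMap.id

end UPos


theorem sum_range_congr_of_eventually_zero {M : Type*} [AddCommMonoid M] {f : ℕ → M} {m n : ℕ}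
    (hm : ∀ k, m ≤ k → f k = 0) (hn : ∀ k, n ≤ k → f k = 0) :
    ∑ k ∈ Finset.range m, f k = ∑ k ∈ Finset.range n, f k := by
  rw [← Finset.eventually_constant_sum hm (le_max_left m n),
    ← Finset.eventually_constant_sum hn (le_max_right m n)]

namespace UPos

variable {I : Type*} [DecidableEq I] (g : I → I → PowerSeries ℂ) (c : ℂ)

theorem act_x (i : I) (n : ℤ) (b : UPos I) : act g c (.x i n) b = xAct g c i n b := rfl

theorem act_phi (i : I) (k : ℕ) (b : UPos I) :
    act g c (.phi i k) b = PowerSeries.coeff k (phiAct g i b) := rfl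

theorem act_phiInv (i : I) (b : UPos I) : act g c (.phiInv i) b = phiInvAct g i b := rfl

theorem act_qc (b : UPos I) : act g c .qc b = b := rfl

theorem act_qcInv (b : UPos I) : act g c .qcInv b = b := rfl

theorem act_phi_mul (i : I) (k : ℕ) (b b' : UPos I) :
    act g c (.phi i k) (b * b') = ∑ p ∈ Finset.HasAntidiagonal.antidiagonal k,
      act g c (.phi i p.1) b * act g c (.phi i p.2) b' := by
  simp only [act_phi, map_mul, PowerSeries.coeff_mul]

theorem act_x_mul (i : I) (n : ℤ) (b b' : UPos I) (N : ℕ)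
    (hN : ∀ k : ℕ, N ≤ k → act g c (.x i (n + k)) b' = 0) :
    act g c (.x i n) (b * b') = act g c (.x i n) b * b'
      + ∑ k ∈ Finset.range N, act g c (.phi i k) b * act g c (.x i (n + k)) b' :=
  xAct_mul g c i n b b' N hN

theorem act_phiInv_mul (i : I) (b b' : UPos I) :
    act g c (.phiInv i) (b * b') = act g c (.phiInv i) b * act g c (.phiInv i) b' := by
  simp only [act_phiInv, map_mul]

theorem act_one (h : PosGen I) :
    act g c h 1 = algebraMap ℂ (UPos I) (counit (FreeAlgebra.ι ℂ h)) := by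
  cases h with
  | x i n => simp [act_x, xAct_one, counit]
  | phi i k =>
    rw [act_phi, map_one, PowerSeries.coeff_one]
    by_cases hk : k = 0 <;> simp [counit, hk]
  | phiInv i => simp [act_phiInv, counit]
  | qc => simp [act_qc, counit]
  | qcInv => simp [act_qcInv, counit]

theorem act_shift_eventually (h : PosGen I) (b : UPos I) :
    ∃ N : ℕ, ∀ k, N ≤ k → rightAct (act g c) (shift k h) b = 0 := by
  cases h with
  | x i n =>
    obtain ⟨M, hM⟩ := xAct_eventually g c i b
    refine ⟨(M - n).toNat, fun k hk => ?_⟩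
    rw [shift, x, rightAct_ι, act_x]
    exact hM _ (by omega)
  | phi i l => exact ⟨l + 1, fun k hk => by rw [shift, if_neg (by omega)]; simp⟩
  | _ => exact ⟨1, fun k hk => by rw [shift, if_neg (by omega)]; simp⟩

/-- How a letter acts on a product that begins with a letter. The formula is symmetric under the
exchange of the acting letter with the first letter of the product, and that is why the form is
symmetric. The sum over `k` is finite by the choice of the cutoff `N`. -/
theorem act_ι_mul (h h' : PosGen I) (b : UPos I) (N : ℕ)
    (hN : ∀ k, N ≤ k → rightAct (act g c) (shift k h) b = 0) :
    act g c h (FreeAlgebra.ι ℂ h' * b) = contract c h h' • b + ∑ k ∈ Finset.range N,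
      pairCoeff g h h' k • (shift k h' * rightAct (act g c) (shift k h) b) := by
  have hz : ∀ k, N ≤ k →
      pairCoeff g h h' k • (shift k h' * rightAct (act g c) (shift k h) b) = 0 := fun k hk => by
    rw [hN k hk, mul_zero, smul_zero]
  cases h with
  | x i n =>
    rw [act_x_mul g c i n _ b N (fun k hk => by simpa [shift, x] using hN k hk), act_x,
      xAct_ι, ← Algebra.smul_def]
    congr 1
    refine Finset.sum_congr rfl fun k _ => ?_
    rw [act_phi, coeff_phiAct_ι, smul_mul_assoc]
    simp only [shift, x, rightAct_ι]
    cases h' <;> rfl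
  | phi i l =>
    rw [act_phi_mul, Finset.Nat.sum_antidiagonal_eq_sum_range_succ_mk, contract, zero_smul,
      zero_add]
    · rw [sum_range_congr_of_eventually_zero hz (n := l + 1) (fun k hk => by
        rw [shift.eq_2 k i l, if_neg (by omega)]; simp)]
      refine Finset.sum_congr rfl fun k hk => ?_
      rw [act_phi, coeff_phiAct_ι, smul_mul_assoc, shift.eq_2 k i l,
        if_pos (by rw [Finset.mem_range] at hk; omega), phi, rightAct_ι]
      cases h' <;> rfl
    · simp
  | phiInv i =>
    rw [sum_range_congr_of_eventually_zero hz (n := 1) (fun k hk => by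
        rw [shift.eq_3, if_neg (by omega)]; simp), act_phiInv_mul, contract, zero_smul, zero_add,
        Finset.sum_range_one, shift_zero, shift_zero, rightAct_ι, act_phiInv, phiInvAct,
        FreeAlgebra.lift_ι_apply, smul_mul_assoc]
    simp
  | qc =>
    rw [sum_range_congr_of_eventually_zero hz (n := 1) (fun k hk => by
        rw [shift.eq_4, if_neg (by omega)]; simp), contract, zero_smul, zero_add,
        Finset.sum_range_one, shift_zero, shift_zero, rightAct_ι]
    · simp [act_qc, pairCoeff, pairSeries]
    · simp
  | qcInv =>
    rw [sum_range_congr_of_eventually_zero hz (n := 1) (fun k hk => by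
        rw [shift.eq_5, if_neg (by omega)]; simp), contract, zero_smul, zero_add,
        Finset.sum_range_one, shift_zero, shift_zero, rightAct_ι]
    · simp [act_qcInv, pairCoeff, pairSeries]
    · simp

/-! ### The symmetric form -/

/-- The bilinear form `(a, b) ↦ ε(b · a)` on the positive algebra. -/
def form : UPos I →ₗ[ℂ] UPos I →ₗ[ℂ] ℂ :=
  (rightAct (act g c)).compr₂ counit.toLinearMap

theorem form_apply (a b : UPos I) : form g c a b = counit (rightAct (act g c) a b) := rfl

theorem form_mul_left (a a' b : UPos I) :
    form g c (a * a') b = form g c a' (rightAct (act g c) a b) := by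
  rw [form_apply, form_apply, rightAct_mul]

theorem form_one_left (b : UPos I) : form g c 1 b = counit b := by
  rw [form_apply, rightAct_one]

theorem form_one_right (a : UPos I) : form g c a 1 = counit a := by
  induction a using mono_induction with
  | mono w =>
    induction w with
    | nil => rw [mono_nil, form_one_left]
    | cons h w ih =>
      rw [mono_cons, form_mul_left, rightAct_ι, act_one, Algebra.algebraMap_eq_smul_one, map_smul,
        ih, map_mul, smul_eq_mul]
  | add a b ha hb => rw [map_add, LinearMap.add_apply, ha, hb, map_add]
  | smul r a ha => rw [map_smul, LinearMap.smul_apply, ha, map_smul]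

variable {g}

/-- Left multiplication by a letter is adjoint to the action of the letter. -/
theorem form_ι_mul_right (hg : ∀ i j, g i j = g j i) (h : PosGen I) (a b : UPos I) :
    form g c a (FreeAlgebra.ι ℂ h * b) = form g c (act g c h a) b := by
  induction a using mono_induction with
  | mono w =>
    induction w generalizing h b with
    | nil =>
      rw [mono_nil, form_one_left, map_mul, act_one, Algebra.algebraMap_eq_smul_one, map_smul,
        LinearMap.smul_apply, form_one_left, smul_eq_mul]
    | cons h' w ih =>
      have ih' : ∀ (k : ℕ) (y : UPos I), form g c (mono w) (shift k h * y)
          = form g c (rightAct (act g c) (shift k h) (mono w)) y := by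
        intro k y
        rcases shift_eq_zero_or k h with h0 | ⟨h1, h0⟩
        · simp [h0]
        · rw [h0, ih, rightAct_ι]
      -- With a common cutoff, both sides expand by `act_ι_mul` into sums that agree term by term.
      obtain ⟨N, hN⟩ := act_shift_eventually g c h' b
      obtain ⟨M, hM⟩ := act_shift_eventually g c h (mono w)
      rw [mono_cons, form_mul_left, rightAct_ι, act_ι_mul g c h' h b (max M N)
        (fun k hk => hN k (le_of_max_le_right hk)), act_ι_mul g c h h' (mono w) (max M N)
        (fun k hk => hM k (le_of_max_le_left hk))]
      simp only [map_add, map_smul, map_sum, LinearMap.add_apply, LinearMap.smul_apply,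
        LinearMap.sum_apply, ih', form_mul_left, contract_comm c h h', pairCoeff_comm g hg h h']
  | add a a' ha ha' => simp only [map_add, LinearMap.add_apply, ha, ha']
  | smul r a ha => simp only [map_smul, LinearMap.smul_apply, ha]

theorem form_comm (hg : ∀ i j, g i j = g j i) (a b : UPos I) : form g c a b = form g c b a := by
  induction b using mono_induction generalizing a with
  | mono w =>
    induction w generalizing a with
    | nil => rw [mono_nil, form_one_left, form_one_right]
    | cons h w ih =>
      rw [mono_cons, form_ι_mul_right c hg, ih, form_mul_left, rightAct_ι]
  | add b b' hb hb' => simp only [map_add, LinearMap.add_apply, hb, hb']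
  | smul r b hb => simp only [map_smul, LinearMap.smul_apply, hb]

theorem form_mul_right (hg : ∀ i j, g i j = g j i) (a b b' : UPos I) :
    form g c a (b * b') = form g c (rightAct (act g c) b a) b' := by
  rw [form_comm c hg, form_mul_left, form_comm c hg]

end UPos


/-! ### Formal series that act like elements of the free algebra -/

section TensorSum

variable {G V : Type*} [Ring V] [Algebra ℂ V]

theorem finsum_tmul_smul (f f' : FreeAlgebra ℂ G →ₗ[ℂ] V) (a a' : FreeAlgebra ℂ G) :
    {p : List G × List G | tmul a a' p.1 p.2 ≠ 0}.Finite ∧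
    ∑ᶠ p : List G × List G, tmul a a' p.1 p.2 • (f (mono p.1) * f' (mono p.2)) = f a * f' a' := by
  have hfin : {p : List G × List G | tmul a a' p.1 p.2 ≠ 0}.Finite :=
    ((coeff_support_finite a).prod (coeff_support_finite a')).subset fun p hp =>
      ⟨left_ne_zero_of_mul hp, right_ne_zero_of_mul hp⟩
  refine ⟨hfin, ?_⟩
  rw [finsum_curry _ (hfin.subset fun p hp => left_ne_zero_of_smul hp)]
  have h : ∀ u : List G, ∑ᶠ v : List G, tmul a a' u v • (f (mono u) * f' (mono v))
        = LinearMap.mulRight ℂ (f' a') (coeff a u • f (mono u)) := by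
    intro u
    rw [LinearMap.mulRight_apply, ← finsum_coeff_smul f' a']
    change _ = LinearMap.mulLeft ℂ (coeff a u • f (mono u)) _
    rw [map_finsum]
    · refine finsum_congr fun v => ?_
      rw [LinearMap.mulLeft_apply, smul_mul_smul_comm, tmul]
    · exact (coeff_support_finite a').subset fun u hu => left_ne_zero_of_smul hu
  simp only [h]
  rw [← map_finsum, finsum_coeff_smul, LinearMap.mulRight_apply]
  exact (coeff_support_finite a).subset fun u hu => left_ne_zero_of_smul hu

variable (act : G → Module.End ℂ V)

/-- A formal series in the tensor square acts on `b ⊗ b'` like an element of the tensor square, if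
the two agree at the words that do not kill `b ⊗ b'`. -/
theorem finsum_smul_of_eq_sum_tmul {κ : Type*} (D : List G → List G → ℂ) (s : Finset κ)
    (a a' : κ → FreeAlgebra ℂ G) (b b' : V)
    (h : ∀ u v, rightAct act (mono u) b ≠ 0 → rightAct act (mono v) b' ≠ 0 →
      D u v = ∑ k ∈ s, tmul (a k) (a' k) u v) :
    {p : List G × List G | D p.1 p.2 ≠ 0 ∧
      rightAct act (mono p.1) b ≠ 0 ∧ rightAct act (mono p.2) b' ≠ 0}.Finite ∧
    ∑ᶠ p : List G × List G, D p.1 p.2 •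
      (rightAct act (mono p.1) b * rightAct act (mono p.2) b')
        = ∑ k ∈ s, rightAct act (a k) b * rightAct act (a' k) b' := by
  constructor
  · refine (s.finite_toSet.biUnion fun k _ => (finsum_tmul_smul ((rightAct act).flip b) ((rightAct act).flip b')
      (a k) (a' k)).1).subset ?_
    rintro p ⟨h1, h2, h3⟩
    rw [h _ _ h2 h3] at h1
    obtain ⟨k, hk, hk'⟩ := Finset.exists_ne_zero_of_sum_ne_zero h1
    exact Set.mem_biUnion (Finset.mem_coe.2 hk) hk'
  · have h' : ∀ p : List G × List G, D p.1 p.2 •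
        (rightAct act (mono p.1) b * rightAct act (mono p.2) b') = ∑ k ∈ s,
          tmul (a k) (a' k) p.1 p.2 •
            (rightAct act (mono p.1) b * rightAct act (mono p.2) b') := by
      intro p
      by_cases h2 : rightAct act (mono p.1) b = 0
      · simp [h2]
      by_cases h3 : rightAct act (mono p.2) b' = 0
      · simp [h3]
      rw [h _ _ h2 h3, Finset.sum_smul]
    simp only [h']
    rw [finsum_sum_comm]
    · exact Finset.sum_congr rfl fun k _ => (finsum_tmul_smul ((rightAct act).flip b) ((rightAct act).flip b')
      (a k) (a' k)).2
    · exact fun k _ => (finsum_tmul_smul ((rightAct act).flip b) ((rightAct act).flip b')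
      (a k) (a' k)).1.subset
        fun p hp => left_ne_zero_of_smul hp

/-- A formal series acts on `b` like an element of the free algebra, if the two agree at the words
that do not kill `b`. -/
theorem finsum_smul_of_eq_coeff (T : List G → ℂ) (a : FreeAlgebra ℂ G) (b : V)
    (h : ∀ u, rightAct act (mono u) b ≠ 0 → T u = coeff a u) :
    {u : List G | T u ≠ 0 ∧ rightAct act (mono u) b ≠ 0}.Finite ∧
    ∑ᶠ u : List G, T u • rightAct act (mono u) b = rightAct act a b := by
  constructor
  · exact (coeff_support_finite a).subset fun u hu => by
      change coeff a u ≠ 0; rw [← h u hu.2]; exact hu.1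
  · rw [show rightAct act a b = (rightAct act).flip b a from rfl,
      ← finsum_coeff_smul ((rightAct act).flip b) a]
    refine finsum_congr fun u => ?_
    rw [LinearMap.flip_apply]
    by_cases hu : rightAct act (mono u) b = 0
    · simp [hu]
    · rw [h u hu]

end TensorSum

theorem coeff_ι_mul_ne_zero {G : Type*} {g : G} {a : FreeAlgebra ℂ G} {u : List G}
    (h : coeff (FreeAlgebra.ι ℂ g * a) u ≠ 0) : ∃ v, u = g :: v := by
  by_contra hu
  refine h ?_
  clear h
  induction a using mono_induction with
  | mono w =>
    rw [← mono_cons, coeff_mono, if_neg]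
    exact fun h => hu ⟨w, h⟩
  | add a b ha hb => rw [mul_add, coeff_add, ha, hb, add_zero]
  | smul r a ha => rw [mul_smul_comm, coeff_smul, ha, mul_zero]

theorem coeff_neg {G : Type*} (a : FreeAlgebra ℂ G) (u : List G) : coeff (-a) u = -coeff a u := by
  simp [coeff]

/-! ### The form and the coproduct -/

namespace UPos

variable {I : Type*} [DecidableEq I] (g : I → I → PowerSeries ℂ) (c : ℂ)

theorem rightAct_K (e : ℤ) (b : UPos I) : rightAct (act g c) (K e) b = b := by
  have h : ∀ n : ℕ, rightAct (act g c) (qc ^ n) b = b ∧ rightAct (act g c) (qcInv ^ n) b = b := by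
    intro n
    induction n with
    | zero => simp
    | succ n ih =>
      rw [pow_succ, pow_succ, rightAct_mul, rightAct_mul, ih.1, ih.2, qc, qcInv, rightAct_ι,
        rightAct_ι]
      exact ⟨rfl, rfl⟩
  cases e with
  | ofNat n => exact (h n).1
  | negSucc n => exact (h (n + 1)).2

theorem rightAct_x (i : I) (n : ℤ) (b : UPos I) :
    rightAct (act g c) (x i n) b = act g c (.x i n) b := by rw [x, rightAct_ι]

theorem rightAct_phi (i : I) (k : ℕ) (b : UPos I) :
    rightAct (act g c) (phi i k) b = act g c (.phi i k) b := by rw [phi, rightAct_ι]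

theorem x_eventually (i : I) (n : ℤ) (b : UPos I) :
    ∃ N : ℕ, ∀ k : ℕ, N ≤ k → act g c (.x i (n + k)) b = 0 := by
  obtain ⟨N, hN⟩ := act_shift_eventually g c (.x i n) b
  exact ⟨N, fun k hk => by simpa [shift, x] using hN k hk⟩

theorem act_mul_eq_finsum_comulGen (h : PosGen I) (b b' : UPos I) :
    {p : List (PosGen I) × List (PosGen I) | comulGen h p.1 p.2 ≠ 0 ∧
      rightAct (act g c) (mono p.1) b ≠ 0 ∧ rightAct (act g c) (mono p.2) b' ≠ 0}.Finite ∧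
    act g c h (b * b') = ∑ᶠ p : List (PosGen I) × List (PosGen I), comulGen h p.1 p.2 •
      (rightAct (act g c) (mono p.1) b * rightAct (act g c) (mono p.2) b') := by
  cases h with
  | x i n =>
    obtain ⟨N, hN⟩ := x_eventually g c i n b'
    have key := finsum_smul_of_eq_sum_tmul (act g c) (comulGen (.x i n))
      (Finset.insertNone (Finset.range N))
      (fun o => o.elim (x i n) fun k => phi i k * K (-(2 * n + k)))
      (fun o => o.elim 1 fun k => x i (n + k)) b b' (fun u v _ hv => by
        -- The terms with `k ≥ N` have `x_{i,n+k}` on the right, which kills `b'`.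
        rw [Finset.sum_insertNone, comulGen, finsum_eq_sum_of_support_subset (s := Finset.range N)]
        · rfl
        intro k hk
        rw [Finset.coe_range, Set.mem_Iio]
        by_contra hk'
        have hv' := right_ne_zero_of_mul hk
        rw [x, ← mono_singleton, coeff_mono] at hv'
        have hv'' : v = [.x i (n + k)] := by
          by_contra h0
          exact hv' (if_neg h0)
        refine hv ?_
        rw [hv'', mono_singleton, rightAct_ι]
        exact hN k (by omega))
    refine ⟨key.1, ?_⟩
    rw [key.2, act_x_mul g c i n b b' N hN, Finset.sum_insertNone]
    simp only [Option.elim, rightAct_one, rightAct_mul, rightAct_K, rightAct_x, rightAct_phi]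
  | phi i k =>
    have key := finsum_smul_of_eq_sum_tmul (act g c) (comulGen (.phi i k))
      (Finset.HasAntidiagonal.antidiagonal k)
      (fun p => phi i p.1 * K (p.2 : ℤ)) (fun p => phi i p.2 * K (-(p.1 : ℤ))) b b'
      (fun u v _ _ => rfl)
    refine ⟨key.1, ?_⟩
    rw [key.2, act_phi_mul]
    simp only [rightAct_mul, rightAct_K, rightAct_phi]
  | phiInv i =>
    have key := finsum_smul_of_eq_sum_tmul (act g c) (comulGen (.phiInv i)) {()}
      (fun _ => phiInv i) (fun _ => phiInv i) b b'
      (fun u v _ _ => by rw [Finset.sum_singleton]; rfl)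
    refine ⟨key.1, ?_⟩
    rw [key.2, act_phiInv_mul, Finset.sum_singleton, phiInv, rightAct_ι]
  | qc =>
    have key := finsum_smul_of_eq_sum_tmul (act g c) (comulGen .qc) {()}
      (fun _ => qc) (fun _ => qc) b b'
      (fun u v _ _ => by rw [Finset.sum_singleton]; rfl)
    refine ⟨key.1, ?_⟩
    rw [key.2, Finset.sum_singleton, qc, rightAct_ι]
    rfl
  | qcInv =>
    have key := finsum_smul_of_eq_sum_tmul (act g c) (comulGen .qcInv) {()}
      (fun _ => qcInv) (fun _ => qcInv) b b'
      (fun u v _ _ => by rw [Finset.sum_singleton]; rfl)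
    refine ⟨key.1, ?_⟩
    rw [key.2, Finset.sum_singleton, qcInv, rightAct_ι]
    rfl

theorem form_mul_right_eq_finsum (a b b' : UPos I) :
    {p : List (PosGen I) × List (PosGen I) |
      comul a p.1 p.2 * (form g c (mono p.1) b * form g c (mono p.2) b') ≠ 0}.Finite ∧
    form g c a (b * b') = ∑ᶠ p : List (PosGen I) × List (PosGen I),
      comul a p.1 p.2 * (form g c (mono p.1) b * form g c (mono p.2) b') := by
  have key := rightAct_map_mul (act g c)
    (fun h b b' => (act_mul_eq_finsum_comulGen g c h b b').1)
    (fun h b b' => (act_mul_eq_finsum_comulGen g c h b b').2) a b b'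
  constructor
  · refine key.1.subset fun p hp => ⟨left_ne_zero_of_mul hp, fun h0 => ?_, fun h0 => ?_⟩
    · exact left_ne_zero_of_mul (right_ne_zero_of_mul hp) (by rw [form_apply, h0, map_zero])
    · exact right_ne_zero_of_mul (right_ne_zero_of_mul hp) (by rw [form_apply, h0, map_zero])
  · rw [form_apply, key.2, map_finsum]
    · simp only [map_smul, map_mul, smul_eq_mul, form_apply, comul]
    · exact key.1.subset fun p hp => ⟨left_ne_zero_of_smul hp,
        left_ne_zero_of_mul (right_ne_zero_of_smul hp),
        right_ne_zero_of_mul (right_ne_zero_of_smul hp)⟩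

end UPos


/-! ### Reversal of words -/

section Reverse

variable {G : Type*}

/-- The anti-automorphism of the free algebra that reverses words. -/
def rev : FreeAlgebra ℂ G →ₗ[ℂ] FreeAlgebra ℂ G :=
  (MulOpposite.opLinearEquiv ℂ).symm.toLinearMap ∘ₗ
    (FreeAlgebra.lift ℂ fun g : G => MulOpposite.op (FreeAlgebra.ι ℂ g)).toLinearMap

theorem rev_one : rev (1 : FreeAlgebra ℂ G) = 1 := by simp [rev]

theorem rev_mul (a b : FreeAlgebra ℂ G) : rev (a * b) = rev b * rev a := by simp [rev]

theorem rev_ι (g : G) : rev (FreeAlgebra.ι ℂ g) = FreeAlgebra.ι ℂ g := by simp [rev]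

theorem rev_mono (w : List G) : rev (mono w) = mono w.reverse := by
  induction w with
  | nil => simp [mono_nil, rev_one]
  | cons g w ih => rw [mono_cons, rev_mul, ih, rev_ι, List.reverse_cons, mono_append, mono_singleton]

theorem rev_rev (a : FreeAlgebra ℂ G) : rev (rev a) = a := by
  have h : rev ∘ₗ rev = (LinearMap.id : FreeAlgebra ℂ G →ₗ[ℂ] _) :=
    linearMap_ext_mono fun w => by simp [rev_mono]
  exact LinearMap.congr_fun h a

theorem algHom_rev {R : Type*} [CommRing R] [Algebra ℂ R] (f : FreeAlgebra ℂ G →ₐ[ℂ] R)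
    (a : FreeAlgebra ℂ G) : f (rev a) = f a := by
  have h : f.toLinearMap ∘ₗ rev = f.toLinearMap := linearMap_ext_mono fun w => by
    induction w with
    | nil => simp [mono_nil, rev_one]
    | cons g w ih =>
      simp only [LinearMap.comp_apply, AlgHom.toLinearMap_apply] at ih ⊢
      rw [mono_cons, rev_mul, rev_ι, map_mul, map_mul, ih, mul_comm]
  exact LinearMap.congr_fun h a

end Reverse

/-! ### The form and the antipode -/

theorem sum_antidiagonal_antidiagonal_comm {M : Type*} [AddCommMonoid M] (f : ℕ → ℕ → ℕ → ℕ → M)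
    (n : ℕ) :
    ∑ p ∈ Finset.HasAntidiagonal.antidiagonal n,
      ∑ q ∈ Finset.HasAntidiagonal.antidiagonal p.1,
        ∑ r ∈ Finset.HasAntidiagonal.antidiagonal p.2, f q.1 q.2 r.1 r.2
    = ∑ p ∈ Finset.HasAntidiagonal.antidiagonal n,
      ∑ q ∈ Finset.HasAntidiagonal.antidiagonal p.1,
        ∑ r ∈ Finset.HasAntidiagonal.antidiagonal p.2, f q.1 r.1 q.2 r.2 := by
  simp only [← Finset.sum_product', Finset.sum_sigma']
  refine Finset.sum_nbij'
    (fun x => ⟨(x.2.1.1 + x.2.2.1, x.2.1.2 + x.2.2.2), ((x.2.1.1, x.2.2.1), (x.2.1.2, x.2.2.2))⟩)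
    (fun x => ⟨(x.2.1.1 + x.2.2.1, x.2.1.2 + x.2.2.2), ((x.2.1.1, x.2.2.1), (x.2.1.2, x.2.2.2))⟩)
    ?_ ?_ ?_ ?_ ?_
  · rintro ⟨⟨a, b⟩, ⟨⟨p, q⟩, ⟨r, s⟩⟩⟩ h
    simp only [Finset.mem_sigma, Finset.HasAntidiagonal.mem_antidiagonal, Finset.mem_product] at h ⊢
    obtain ⟨hn, rfl, rfl⟩ := h
    simp only [and_self, and_true] at hn ⊢
    omega
  · rintro ⟨⟨a, b⟩, ⟨⟨p, q⟩, ⟨r, s⟩⟩⟩ h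
    simp only [Finset.mem_sigma, Finset.HasAntidiagonal.mem_antidiagonal, Finset.mem_product] at h ⊢
    obtain ⟨hn, rfl, rfl⟩ := h
    simp only [and_self, and_true] at hn ⊢
    omega
  · rintro ⟨⟨a, b⟩, ⟨⟨p, q⟩, ⟨r, s⟩⟩⟩ h
    simp only [Finset.mem_sigma, Finset.HasAntidiagonal.mem_antidiagonal, Finset.mem_product] at h
    obtain ⟨-, rfl, rfl⟩ := h
    rfl
  · rintro ⟨⟨a, b⟩, ⟨⟨p, q⟩, ⟨r, s⟩⟩⟩ h
    simp only [Finset.mem_sigma, Finset.HasAntidiagonal.mem_antidiagonal, Finset.mem_product] at h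
    obtain ⟨-, rfl, rfl⟩ := h
    rfl
  · rintro ⟨⟨a, b⟩, ⟨⟨p, q⟩, ⟨r, s⟩⟩⟩ _
    rfl

/-- A double sum over a triangle. -/
theorem sum_range_sum_range_eq_antidiagonal {M : Type*} [AddCommMonoid M] (F : ℕ → ℕ → M) (N : ℕ)
    (hF : ∀ k l, N ≤ k + l → F k l = 0) :
    ∑ k ∈ Finset.range N, ∑ l ∈ Finset.range N, F k l
      = ∑ m ∈ Finset.range N, ∑ p ∈ Finset.HasAntidiagonal.antidiagonal m, F p.1 p.2 := by
  simp only [Finset.Nat.sum_antidiagonal_eq_sum_range_succ F]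
  rw [Finset.sum_range_diag_flip]
  exact Finset.sum_congr rfl fun k _ => sum_range_congr_of_eventually_zero
    (fun l hl => hF k l (by omega)) (fun l hl => hF k l (by omega))

namespace UPos

variable {I : Type*} (g g' : I → I → PowerSeries ℂ)

theorem rev_shift (k : ℕ) (h : PosGen I) : rev (shift k h) = shift k h := by
  rcases shift_eq_zero_or k h with h0 | ⟨h', h0⟩
  · rw [h0, map_zero]
  · rw [h0, rev_ι]

theorem coeff_phiAct_shift (i : I) (k l : ℕ) (h : PosGen I) :
    PowerSeries.coeff l (phiAct g i (shift k h))
      = pairCoeff g (.phi i 0) h l • shift (k + l) h := by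
  cases h with
  | x j n =>
    rw [shift, x, coeff_phiAct_ι]
    simp only [shift, Nat.cast_add, add_assoc]
    rfl
  | phi j m =>
    simp only [shift]
    split_ifs with h1 h2 h2
    · rw [phi, coeff_phiAct_ι, shift.eq_2, if_pos (by omega), Nat.sub_sub]
      rfl
    · rw [phi, coeff_phiAct_ι, shift.eq_2, if_neg (by omega), smul_zero, smul_zero]
    · omega
    · simp
  | phiInv j =>
    simp only [shift]
    split_ifs with h1 h2 h2
    · rw [phiInv, coeff_phiAct_ι, shift.eq_3, if_pos (by omega)]
      rfl
    · rw [phiInv, coeff_phiAct_ι, shift.eq_3, if_neg (by omega), smul_zero]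
    · omega
    · simp
  | qc =>
    simp only [shift]
    split_ifs with h1 h2 h2
    · rw [qc, coeff_phiAct_ι, shift.eq_4, if_pos (by omega)]
      rfl
    · rw [qc, coeff_phiAct_ι, shift.eq_4, if_neg (by omega), smul_zero]
    · omega
    · simp
  | qcInv =>
    simp only [shift]
    split_ifs with h1 h2 h2
    · rw [qcInv, coeff_phiAct_ι, shift.eq_5, if_pos (by omega)]
      rfl
    · rw [qcInv, coeff_phiAct_ι, shift.eq_5, if_neg (by omega), smul_zero]
    · omega
    · simp

variable {g g'}

theorem coeff_zero_mul_of_mul_eq_one (hgg : ∀ i j, g i j * g' i j = 1) (i j : I) :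
    PowerSeries.coeff 0 (g i j) * PowerSeries.coeff 0 (g' i j) = 1 := by
  have := congrArg PowerSeries.constantCoeff (hgg i j)
  simpa using this

theorem pairSeries_mul (hgg : ∀ i j, g i j * g' i j = 1) (h h' : PosGen I) :
    pairSeries g h h' * pairSeries g' h h' = 1 := by
  have h0 := coeff_zero_mul_of_mul_eq_one hgg
  cases h <;> cases h' <;> simp only [pairSeries, hgg, mul_one, ← map_mul, ← mul_inv, h0, inv_one,
    map_one]

variable (g) [DecidableEq I] (c : ℂ)

theorem act_phi_rev (i : I) (k : ℕ) (b : UPos I) :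
    act g c (.phi i k) (rev b) = rev (act g c (.phi i k) b) := by
  induction b using mono_induction generalizing k with
  | mono w =>
    induction w generalizing k with
    | nil =>
      rw [mono_nil, rev_one, act_one, Algebra.algebraMap_eq_smul_one, map_smul, rev_one]
    | cons h w ih =>
      rw [mono_cons, rev_mul, act_phi_mul, act_phi_mul, map_sum,
        ← Finset.Nat.sum_antidiagonal_swap]
      refine Finset.sum_congr rfl fun p _ => ?_
      rw [rev_mul, Prod.fst_swap, Prod.snd_swap, ih, rev_ι, act_phi g c i p.1, coeff_phiAct_ι,
        map_smul, rev_shift]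
  | add a b ha hb => simp only [map_add, ha, hb]
  | smul r a ha => simp only [map_smul, ha]

variable {g}

theorem act_phi_zero_act_phiInv (hg0 : ∀ i j, PowerSeries.coeff 0 (g i j) ≠ 0) (i : I)
    (b : UPos I) : act g c (.phi i 0) (act g c (.phiInv i) b) = b := by
  induction b using mono_induction with
  | mono w =>
    induction w with
    | nil => simp [mono_nil, act_one, counit]
    | cons h w ih =>
      rw [mono_cons, act_phiInv_mul, act_phi_mul, Finset.HasAntidiagonal.antidiagonal_zero, Finset.sum_singleton,
        ih, act_phiInv, phiInvAct, FreeAlgebra.lift_ι_apply, map_smul, act_phi, coeff_phiAct_ι,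
        shift_zero, smul_smul]
      have h1 : pairCoeff g (.phiInv i) h 0 * pairCoeff g (.phi i 0) h 0 = 1 := by
        cases h <;> simp [pairCoeff, pairSeries] <;>
          field_simp [(by simpa using hg0 : ∀ i j, PowerSeries.constantCoeff (g i j) ≠ 0)]
      rw [h1, one_smul]
  | add a b ha hb => simp only [map_add, ha, hb]
  | smul r a ha => simp only [map_smul, ha]

/-- The operators of `φ_i(z)` for `g` and `1 / g` are inverse to each other. -/
theorem sum_act_phi_act_phi (hgg : ∀ i j, g i j * g' i j = 1) (c' : ℂ) (i : I) (k : ℕ)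
    (b : UPos I) :
    ∑ p ∈ Finset.HasAntidiagonal.antidiagonal k, act g' c' (.phi i p.2) (act g c (.phi i p.1) b)
      = if k = 0 then b else 0 := by
  induction b using mono_induction generalizing k with
  | mono w =>
    induction w generalizing k with
    | nil =>
      simp only [mono_nil, act_phi, map_one, PowerSeries.coeff_one]
      by_cases hk : k = 0
      · subst hk; simp
      · rw [if_neg hk]
        refine Finset.sum_eq_zero fun p hp => ?_
        rw [Finset.HasAntidiagonal.mem_antidiagonal] at hp
        by_cases h1 : p.1 = 0
        · rw [if_pos h1, map_one, PowerSeries.coeff_one, if_neg (by omega)]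
        · rw [if_neg h1, map_zero, map_zero]
    | cons h w ih =>
      simp only [mono_cons, act_phi_mul, map_sum]
      have hq : ∀ (p q : ℕ) (y : UPos I), act g' c' (.phi i q)
          (act g c (.phi i p) (FreeAlgebra.ι ℂ h)) * y
            = (pairCoeff g (.phi i 0) h p * pairCoeff g' (.phi i 0) h q) • (shift (p + q) h * y) := by
        intro p q y
        rw [act_phi g c, coeff_phiAct_ι, map_smul, act_phi, coeff_phiAct_shift, smul_smul,
          smul_mul_assoc]
      simp only [hq]
      rw [sum_antidiagonal_antidiagonal_comm fun p1 p2 q1 q2 =>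
        (pairCoeff g (.phi i 0) h p1 * pairCoeff g' (.phi i 0) h q1) •
          (shift (p1 + q1) h * act g' c' (.phi i q2) (act g c (.phi i p2) (mono w)))]
      have h1 : ∀ p ∈ Finset.HasAntidiagonal.antidiagonal k,
          ∑ q ∈ Finset.HasAntidiagonal.antidiagonal p.1,
            ∑ r ∈ Finset.HasAntidiagonal.antidiagonal p.2,
              (pairCoeff g (.phi i 0) h q.1 * pairCoeff g' (.phi i 0) h q.2) •
              (shift (q.1 + q.2) h * act g' c' (.phi i r.2) (act g c (.phi i r.1) (mono w)))
          = (if p.1 = 0 then (1 : ℂ) else 0) •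
            (shift p.1 h * if p.2 = 0 then mono w else 0) := by
        intro p _
        rw [← ih, ← PowerSeries.coeff_one, ← pairSeries_mul hgg (.phi i 0) h,
          PowerSeries.coeff_mul, Finset.sum_smul]
        refine Finset.sum_congr rfl fun q hq' => ?_
        rw [Finset.HasAntidiagonal.mem_antidiagonal] at hq'
        rw [← Finset.smul_sum, ← Finset.mul_sum, hq']
        rfl
      rw [Finset.sum_congr rfl h1]
      by_cases hk : k = 0
      · subst hk; simp [shift_zero]
      · rw [if_neg hk]
        refine Finset.sum_eq_zero fun p hp => ?_
        rw [Finset.HasAntidiagonal.mem_antidiagonal] at hp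
        by_cases h1 : p.1 = 0
        · rw [if_neg (by omega : p.2 ≠ 0), mul_zero, smul_zero]
        · rw [if_neg h1, zero_smul]
  | add a b ha hb => simp only [map_add, Finset.sum_add_distrib, ha, hb]; split_ifs <;> simp
  | smul r a ha => simp only [map_smul, ← Finset.smul_sum, ha]; split_ifs <;> simp

theorem act_phiInv_eq (hgg : ∀ i j, g i j * g' i j = 1) (c' : ℂ) (i : I) (b : UPos I) :
    act g c (.phiInv i) b = act g' c' (.phi i 0) b := by
  have hg0 : ∀ i j, PowerSeries.coeff 0 (g i j) ≠ 0 := fun i j =>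
    left_ne_zero_of_mul_eq_one (coeff_zero_mul_of_mul_eq_one hgg i j)
  have := sum_act_phi_act_phi c hgg c' i 0 (act g c (.phiInv i) b)
  rw [Finset.HasAntidiagonal.antidiagonal_zero, Finset.sum_singleton, if_pos rfl,
    act_phi_zero_act_phiInv c hg0] at this
  exact this.symm

/-- `φ_i(z)⁻¹` acts like `φ_i(z)` with `g` replaced by `1 / g`. -/
theorem rightAct_phiS (hgg : ∀ i j, g i j * g' i j = 1) (c' : ℂ) (i : I) (k : ℕ)
    (b : UPos I) :
    rightAct (act g c) (phiS i k) b = act g' c' (.phi i k) b := by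
  induction k using Nat.strong_induction_on generalizing b with
  | _ k ih =>
    cases k with
    | zero => rw [phiS, invCoeff, phiInv, rightAct_ι, act_phiInv_eq c hgg c']
    | succ n =>
      have hg0 : ∀ i j, PowerSeries.coeff 0 (g i j) ≠ 0 := fun i j =>
        left_ne_zero_of_mul_eq_one (coeff_zero_mul_of_mul_eq_one hgg i j)
      set b' := act g c (.phiInv i) b with hb'
      have h1 := sum_act_phi_act_phi c hgg c' i (n + 1) b'
      rw [if_neg (by omega), ← Finset.Nat.sum_antidiagonal_swap,
        Finset.Nat.sum_antidiagonal_eq_sum_range_succ_mk, Finset.sum_range_succ] at h1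
      simp only [Prod.fst_swap, Prod.snd_swap, Nat.sub_self] at h1
      rw [hb', act_phi_zero_act_phiInv c hg0, ← hb'] at h1
      rw [phiS, invCoeff, map_neg, LinearMap.neg_apply, rightAct_mul, phiInv, rightAct_ι, ← hb',
        map_sum, LinearMap.sum_apply, neg_eq_iff_add_eq_zero, ← h1,
        ← Fin.sum_univ_eq_sum_range (fun s => act g' c' (.phi i s)
          (act g c (.phi i (n + 1 - s)) b'))]
      congr 1
      refine Finset.sum_congr rfl fun s _ => ?_
      rw [rightAct_mul, rightAct_phi]
      exact ih s (by omega) _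

end UPos


namespace UPos

variable {I : Type*} [DecidableEq I] {g g' : I → I → PowerSeries ℂ} (c : ℂ)

/-- The case of a word in `sum_act_phi_act_x`, by induction on its last letter, which becomes the
first letter of the reversed word. -/
theorem sum_act_phi_act_x_mono (hgg : ∀ i j, g i j * g' i j = 1) (i : I) (w : List (PosGen I))
    (n : ℤ) (N : ℕ) (hN : ∀ k : ℕ, N ≤ k → act g c (.x i (n + k)) (mono w) = 0) :
    ∑ k ∈ Finset.range N, act g' (-c) (.phi i k) (act g c (.x i (n + k)) (mono w))
      = -rev (act g' (-c) (.x i n) (rev (mono w))) := by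
  induction w using List.reverseRecOn generalizing n N with
  | nil => simp [mono_nil, rev_one, act_one, counit]
  | append_singleton w h ih =>
    obtain ⟨N₁, h₁⟩ := x_eventually g c i n (mono w)
    obtain ⟨N₂, h₂⟩ := x_eventually g c i n (FreeAlgebra.ι ℂ h)
    obtain ⟨N₃, h₃⟩ := x_eventually g' (-c) i n (rev (mono w))
    obtain ⟨M, hM, hM₁, hM₂, hM₃, hM₀⟩ : ∃ M, N ≤ M ∧ N₁ ≤ M ∧ N₂ ≤ M ∧ N₃ ≤ M ∧ 1 ≤ M :=
      ⟨N + N₁ + N₂ + N₃ + 1, by omega, by omega, by omega, by omega, by omega⟩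
    have hcast : ∀ k l : ℕ, n + k + l = n + ((k + l : ℕ) : ℤ) := fun k l => by push_cast; ring
    have hx : ∀ m : ℤ, act g c (.x i m) (FreeAlgebra.ι ℂ h)
        = algebraMap ℂ _ (contract c (.x i m) h) := fun m => xAct_ι g c i m h
    have hx' : act g' (-c) (.x i n) (FreeAlgebra.ι ℂ h)
        = -algebraMap ℂ _ (contract c (.x i n) h) := by
      rw [act_x, xAct_ι, ← map_neg]
      congr 1
      cases h <;> simp [contract]
      split_ifs <;> simp
    rw [sum_range_congr_of_eventually_zero (n := M) (fun k hk => by rw [hN k hk, map_zero])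
      (fun k hk => by rw [hN k (by omega), map_zero]), mono_append, mono_singleton]
    -- Each term on the left is expanded by the product rules for `x` and for `φ`.
    have hterm : ∀ k : ℕ, act g' (-c) (.phi i k)
          (act g c (.x i (n + k)) (mono w * FreeAlgebra.ι ℂ h))
        = (∑ p ∈ Finset.HasAntidiagonal.antidiagonal k,
            act g' (-c) (.phi i p.1) (act g c (.x i (n + ((p.1 + p.2 : ℕ) : ℤ))) (mono w))
              * act g' (-c) (.phi i p.2) (FreeAlgebra.ι ℂ h))
          + ∑ l ∈ Finset.range M, contract c (.x i (n + ((k + l : ℕ) : ℤ))) h •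
            act g' (-c) (.phi i k) (act g c (.phi i l) (mono w)) := by
      intro k
      rw [act_x_mul g c i (n + k) _ _ M (fun l hl => by rw [hcast]; exact h₂ _ (by omega)),
        map_add, act_phi_mul, map_sum]
      congr 1
      · refine Finset.sum_congr rfl fun p hp => ?_
        rw [Finset.HasAntidiagonal.mem_antidiagonal] at hp
        rw [hp]
      · refine Finset.sum_congr rfl fun l _ => ?_
        rw [hx, ← Algebra.commutes, ← Algebra.smul_def, map_smul, hcast]
    rw [Finset.sum_congr rfl fun k _ => hterm k, Finset.sum_add_distrib,
      ← sum_range_sum_range_eq_antidiagonal (fun p q =>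
        act g' (-c) (.phi i p) (act g c (.x i (n + ((p + q : ℕ) : ℤ))) (mono w))
              * act g' (-c) (.phi i q) (FreeAlgebra.ι ℂ h)) M
        (fun p q hpq => by rw [h₁ _ (by omega), map_zero, zero_mul]),
      sum_range_sum_range_eq_antidiagonal (fun k l => contract c (.x i (n + ((k + l : ℕ) : ℤ))) h •
            act g' (-c) (.phi i k) (act g c (.phi i l) (mono w))) M
        (fun k l hkl => by
          have := h₂ (k + l) (by omega)
          rw [hx] at this
          rw [(FreeAlgebra.algebraMap_eq_zero_iff _).1 this, zero_smul])]
    -- Along the diagonals, the operators of `φ` for `g` and for `1 / g` cancel.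
    have hsecond : ∀ m ∈ Finset.range M, ∑ p ∈ Finset.HasAntidiagonal.antidiagonal m,
          contract c (.x i (n + ((p.1 + p.2 : ℕ) : ℤ))) h •
            act g' (-c) (.phi i p.1) (act g c (.phi i p.2) (mono w))
        = if m = 0 then contract c (.x i n) h • mono w else 0 := by
      intro m _
      have h0 := sum_act_phi_act_phi c hgg (-c) i m (mono w)
      rw [← Finset.Nat.sum_antidiagonal_swap] at h0
      rw [Finset.sum_congr rfl fun p hp => by
        rw [Finset.HasAntidiagonal.mem_antidiagonal.1 hp], ← Finset.smul_sum]
      simp only [Prod.fst_swap, Prod.snd_swap] at h0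
      rw [h0]
      by_cases hm : m = 0
      · simp [hm]
      · simp [hm]
    rw [Finset.sum_congr rfl hsecond, Finset.sum_ite_eq', if_pos (Finset.mem_range.2 hM₀),
      Finset.sum_comm, rev_mul, rev_ι, act_x_mul g' (-c) i n _ _ M
        (fun k hk => h₃ k (by omega)), map_add, rev_mul, rev_rev, map_sum, hx', map_neg,
      Algebra.algebraMap_eq_smul_one, map_smul, rev_one, neg_add, mul_neg, neg_neg,
      mul_smul_comm, mul_one, add_comm, ← Finset.sum_neg_distrib]
    congr 1
    refine Finset.sum_congr rfl fun q _ => ?_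
    rw [← Finset.sum_mul, rev_mul, ← act_phi_rev, rev_ι, ← neg_mul, ← ih (n + q) M
      (fun k hk => by rw [hcast]; exact h₁ _ (by omega))]
    congr 1
    refine Finset.sum_congr rfl fun p _ => ?_
    rw [hcast, add_comm p q]

/-- Up to sign, the left side is the action of `S⁻¹(x_{i,n})` on `b`, and the right side is the
action of `x_{i,n}` for the parameters `1 / g` and `-c` on the reversed words. -/
theorem sum_act_phi_act_x (hgg : ∀ i j, g i j * g' i j = 1) (i : I) (b : UPos I)
    (n : ℤ) (N : ℕ) (hN : ∀ k : ℕ, N ≤ k → act g c (.x i (n + k)) b = 0) :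
    ∑ k ∈ Finset.range N, act g' (-c) (.phi i k) (act g c (.x i (n + k)) b)
      = -rev (act g' (-c) (.x i n) (rev b)) := by
  have key : ∃ N₀, ∀ N, N₀ ≤ N →
      ∑ k ∈ Finset.range N, act g' (-c) (.phi i k) (act g c (.x i (n + k)) b)
      = -rev (act g' (-c) (.x i n) (rev b)) := by
    clear hN
    induction b using mono_induction with
    | mono w =>
      obtain ⟨N₀, h₀⟩ := x_eventually g c i n (mono w)
      exact ⟨N₀, fun N hN => sum_act_phi_act_x_mono c hgg i w n N fun k hk => h₀ k (by omega)⟩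
    | add a b ha hb =>
      obtain ⟨N₁, h₁⟩ := ha
      obtain ⟨N₂, h₂⟩ := hb
      refine ⟨max N₁ N₂, fun N hN => ?_⟩
      simp only [map_add, Finset.sum_add_distrib, h₁ N (le_of_max_le_left hN),
        h₂ N (le_of_max_le_right hN), neg_add]
    | smul r a ha =>
      obtain ⟨N₁, h₁⟩ := ha
      refine ⟨N₁, fun N hN => ?_⟩
      simp only [map_smul, ← Finset.smul_sum, h₁ N hN, smul_neg]
  obtain ⟨N₀, h₀⟩ := key
  rw [← h₀ (max N₀ N) (le_max_left _ _)]
  exact sum_range_congr_of_eventually_zero (fun k hk => by rw [hN k hk, map_zero])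
    (fun k hk => by rw [hN k (le_of_max_le_right hk), map_zero])

/-- The formal series `S⁻¹(h)` acts like the letter `h` for the parameters `1 / g` and `-c`, on the
reversed words. -/
theorem finsum_antipodeInvGen (hgg : ∀ i j, g i j * g' i j = 1) (h : PosGen I) (b : UPos I) :
    {u : List (PosGen I) | antipodeInvGen h u ≠ 0 ∧ rightAct (act g c) (mono u) b ≠ 0}.Finite ∧
    (rev ∘ₗ act g' (-c) h ∘ₗ rev) b
      = ∑ᶠ u : List (PosGen I), antipodeInvGen h u • rightAct (act g c) (mono u) b := by
  have hgg' : ∀ i j, g' i j * g i j = 1 := fun i j => by rw [mul_comm, hgg]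
  have key : ∃ a : UPos I, (∀ u, rightAct (act g c) (mono u) b ≠ 0 →
      antipodeInvGen h u = coeff a u) ∧
      rightAct (act g c) a b = rev (act g' (-c) h (rev b)) := by
    cases h with
    | x i n =>
      obtain ⟨N, hN⟩ := x_eventually g c i n b
      refine ⟨∑ k ∈ Finset.range N,
        -(x i (n + k) * K (2 * (n + k)) * (phiS i k * K (-(k : ℤ)))), fun u hu => ?_, ?_⟩
      · rw [antipodeInvGen, finsum_eq_sum_of_support_subset (s := Finset.range N)]
        · simp [coeff]
        -- The words in the terms with `k ≥ N` begin with `x_{i,n+k}`, which kills `b`.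
        intro k hk
        rw [Finset.coe_range, Set.mem_Iio]
        by_contra hk'
        rw [Function.mem_support, coeff_neg, neg_ne_zero, mul_assoc, x] at hk
        obtain ⟨v, rfl⟩ := coeff_ι_mul_ne_zero hk
        exact hu (by rw [rightAct_mono_cons, hN k (by omega), map_zero])
      · rw [map_sum, LinearMap.sum_apply, ← neg_neg (rev _), ← sum_act_phi_act_x c hgg i b n N hN,
          ← Finset.sum_neg_distrib]
        refine Finset.sum_congr rfl fun k _ => ?_
        rw [map_neg, LinearMap.neg_apply, rightAct_mul, rightAct_mul, rightAct_mul, rightAct_K,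
          rightAct_K, rightAct_phiS c hgg (-c), rightAct_x]
    | phi i k =>
      exact ⟨phiS i k, fun _ _ => rfl, by
        rw [rightAct_phiS c hgg (-c), act_phi_rev, rev_rev]⟩
    | phiInv i =>
      exact ⟨phi i 0, fun _ _ => rfl, by
        rw [act_phiInv_eq (-c) hgg' c, act_phi_rev, rev_rev, rightAct_phi]⟩
    | qc => exact ⟨qcInv, fun _ _ => rfl, by rw [act_qc, rev_rev, qcInv, rightAct_ι, act_qcInv]⟩
    | qcInv => exact ⟨qc, fun _ _ => rfl, by rw [act_qcInv, rev_rev, qc, rightAct_ι, act_qc]⟩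
  obtain ⟨a, ha, ha'⟩ := key
  have := finsum_smul_of_eq_coeff (act g c) (antipodeInvGen h) a b ha
  exact ⟨this.1, by rw [this.2, ha']; rfl⟩

theorem form_antipodeInv (hgg : ∀ i j, g i j * g' i j = 1) (a b : UPos I) :
    {u : List (PosGen I) | antipodeInv a u * form g c (mono u) b ≠ 0}.Finite ∧
    ∑ᶠ u : List (PosGen I), antipodeInv a u * form g c (mono u) b
      = form g' (-c) (rev a) (rev b) := by
  induction a using mono_induction with
  | mono w =>
    have key := finsum_antiWord (act g c) (T := antipodeInvGen)
      (R := fun h => rev ∘ₗ act g' (-c) h ∘ₗ rev)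
      (fun h b => (finsum_antipodeInvGen c hgg h b).1)
      (fun h b => (finsum_antipodeInvGen c hgg h b).2) w b
    have hprod : (w.map fun h => (rev ∘ₗ act g' (-c) h ∘ₗ rev : Module.End ℂ (UPos I))).prod b
        = rev (rightAct (act g' (-c)) (mono w.reverse) (rev b)) := by
      clear key
      induction w with
      | nil => simp [mono_nil, rev_rev]
      | cons h w ih =>
        rw [List.map_cons, List.prod_cons, Module.End.mul_apply, ih, List.reverse_cons,
          rightAct_mono_append, mono_singleton, rightAct_ι]
        simp only [LinearMap.comp_apply, rev_rev]
    simp only [antipodeInv, antiExt_mono]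
    constructor
    · exact key.1.subset fun u hu => ⟨left_ne_zero_of_mul hu, fun h0 =>
        right_ne_zero_of_mul hu (by rw [form_apply, h0, map_zero])⟩
    · rw [rev_mono, form_apply, ← algHom_rev, ← hprod, ← key.2, map_finsum]
      · simp only [map_smul, smul_eq_mul, form_apply]
      · exact key.1.subset fun u hu => ⟨left_ne_zero_of_smul hu, right_ne_zero_of_smul hu⟩
  | add a a' ha ha' =>
    simp only [antipodeInv, antiExt_add, add_mul, map_add, LinearMap.add_apply] at ha ha' ⊢
    refine ⟨(ha.1.union ha'.1).subset (Function.support_add _ _), ?_⟩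
    rw [finsum_add_distrib ha.1 ha'.1, ha.2, ha'.2]
  | smul r a ha =>
    simp only [antipodeInv, antiExt_smul, mul_assoc, map_smul, LinearMap.smul_apply] at ha ⊢
    refine ⟨ha.1.subset fun u hu => right_ne_zero_of_mul hu, ?_⟩
    rw [← ha.2, smul_eq_mul, mul_finsum]

theorem form_antipodeInv_comm (hg : ∀ i j, g i j = g j i) (hgg : ∀ i j, g i j * g' i j = 1)
    (a b : UPos I) :
    ∑ᶠ u : List (PosGen I), antipodeInv a u * form g c (mono u) b
      = ∑ᶠ u : List (PosGen I), antipodeInv b u * form g c a (mono u) := by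
  have hg' : ∀ i j, g' i j = g' j i := fun i j => by
    have h1 := hgg i j
    rw [hg i j] at h1
    have h2 : g j i ≠ 0 := left_ne_zero_of_mul_eq_one h1
    exact mul_left_cancel₀ h2 (h1.trans (hgg j i).symm)
  simp only [form_comm c hg a]
  rw [(form_antipodeInv c hgg a b).2, (form_antipodeInv c hgg b a).2, form_comm _ hg']

end UPos


namespace UPos

/-! ### The radical of the form -/

variable {I : Type*} [DecidableEq I] {g g' : I → I → PowerSeries ℂ} (c : ℂ)

theorem form_K_mul_right (hg : ∀ i j, g i j = g j i) (e : ℤ) (a b : UPos I) :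
    form g c a (K e * b) = form g c a b := by
  rw [form_mul_right c hg, rightAct_K]

theorem form_eq_counit_of_act_eq_id {h : PosGen I} (hh : ∀ b, act g c h b = b) (b : UPos I) :
    form g c (FreeAlgebra.ι ℂ h) b = counit b := by
  rw [form_apply, rightAct_ι, hh]

theorem form_commutator_eq_zero (hg : ∀ i j, g i j = g j i) {h : PosGen I}
    (hh : ∀ b, act g c h b = b) (a b : UPos I) :
    form g c a (FreeAlgebra.ι ℂ h * b - b * FreeAlgebra.ι ℂ h) = 0 := by
  rw [map_sub, form_mul_right c hg, rightAct_ι, hh, form_mul_right c hg,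
    form_comm c hg _ (FreeAlgebra.ι ℂ h), form_eq_counit_of_act_eq_id c hh, ← form_apply,
    form_comm c hg b, sub_self]

theorem form_mul_sub_one_eq_zero (hg : ∀ i j, g i j = g j i) {h h' : PosGen I}
    (hh : ∀ b, act g c h' (act g c h b) = b) (a : UPos I) :
    form g c a (FreeAlgebra.ι ℂ h * FreeAlgebra.ι ℂ h' - 1) = 0 := by
  rw [form_comm c hg, map_sub, LinearMap.sub_apply, form_mul_left, rightAct_ι, form_apply,
    rightAct_ι, hh, form_one_left, sub_self]

theorem act_phi_act_phi_ι_comm (i j : I) (k l : ℕ) (h : PosGen I) :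
    act g c (.phi i k) (act g c (.phi j l) (FreeAlgebra.ι ℂ h))
      = act g c (.phi j l) (act g c (.phi i k) (FreeAlgebra.ι ℂ h)) := by
  rw [act_phi g c j, coeff_phiAct_ι, map_smul, act_phi, coeff_phiAct_shift, act_phi g c i,
    coeff_phiAct_ι, map_smul, act_phi, coeff_phiAct_shift, smul_comm, add_comm k l]

theorem act_phi_act_phi_comm (i j : I) (k l : ℕ) (b : UPos I) :
    act g c (.phi i k) (act g c (.phi j l) b) = act g c (.phi j l) (act g c (.phi i k) b) := by
  induction b using mono_induction generalizing k l with
  | mono w =>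
    induction w generalizing k l with
    | nil => simp only [mono_nil, act_one, Algebra.algebraMap_eq_smul_one, map_smul]
             rw [smul_comm]
    | cons h w ih =>
      simp only [mono_cons, act_phi_mul, map_sum]
      rw [Finset.sum_comm]
      refine Finset.sum_congr rfl fun p _ => Finset.sum_congr rfl fun q _ => ?_
      rw [ih, act_phi_act_phi_ι_comm]
  | add a b ha hb => simp only [map_add, ha, hb]
  | smul r a ha => simp only [map_smul, ha]

/-- The elements expressing `φ_i(z) x_j(w) = g_ij(z / w) x_j(w) φ_i(z)`, with the central letters
left out and the modes of `φ_i` shifted by `p`. Their span is stable under the action of the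
letters. -/
def crossRel (g : I → I → PowerSeries ℂ) (i j : I) (k p : ℕ) (m : ℤ) : UPos I :=
  shift p (.phi i k) * x j m - ∑ l ∈ Finset.range (k + 1),
    PowerSeries.coeff l (g i j) • (x j (m - l) * shift (p + l) (.phi i k))

omit [DecidableEq I] in
theorem counit_crossRel (i j : I) (k p : ℕ) (m : ℤ) : counit (crossRel g i j k p m) = 0 := by
  have h : ∀ m, counit (x j m) = 0 := fun m => by simp [counit, x]
  simp [crossRel, h]

theorem act_x_shift_phi (s i : I) (M : ℤ) (k p : ℕ) :
    act g c (.x s M) (shift p (.phi i k)) = 0 := by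
  rw [shift]
  split_ifs
  · rw [phi, act_x, xAct_ι, contract, map_zero]
    simp
  · rw [map_zero]

theorem act_x_crossRel (hg : ∀ i j, g i j = g j i) (s i j : I) (k p : ℕ) (M m : ℤ) :
    act g c (.x s M) (crossRel g i j k p m) = 0 := by
  obtain ⟨N, hN⟩ := x_eventually g c s M (x j m)
  have h1 := act_x_mul g c s M (shift p (.phi i k)) (x j m) N hN
  rw [act_x_shift_phi, zero_mul, zero_add] at h1
  have h2 : ∀ l : ℕ, act g c (.x s M) (x j (m - l) * shift (p + l) (.phi i k))
      = act g c (.x s M) (x j (m - l)) * shift (p + l) (.phi i k) := fun l => by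
    rw [act_x_mul g c s M _ _ 0 fun k _ => act_x_shift_phi c _ _ _ _ _]
    simp
  rw [crossRel, map_sub, h1, map_sum, sum_range_congr_of_eventually_zero (n := k + 1)
    (fun l hl => by rw [hN l hl, mul_zero]) (fun l hl => by
      rw [act_phi, coeff_phiAct_shift, shift.eq_2, if_neg (by omega), smul_zero, zero_mul]),
    ← Finset.sum_sub_distrib]
  refine Finset.sum_eq_zero fun l _ => ?_
  rw [map_smul, h2, act_phi, coeff_phiAct_shift, x, act_x, xAct_ι, x, act_x, xAct_ι,
    ← Algebra.commutes, ← Algebra.smul_def, ← Algebra.smul_def, contract, contract, sub_eq_zero,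
    pairCoeff, pairSeries]
  by_cases hs : s = j
  · subst hs
    rw [hg, smul_comm]
    simp only [true_and, eq_sub_iff_add_eq]
  · simp [hs]

theorem act_phi_crossRel (s i j : I) (t k p : ℕ) (m : ℤ) :
    act g c (.phi s t) (crossRel g i j k p m)
      = ∑ q ∈ Finset.HasAntidiagonal.antidiagonal t,
        (PowerSeries.coeff q.1 (g s i) * PowerSeries.coeff q.2 (g s j)) •
          crossRel g i j k (p + q.1) (m + q.2) := by
  have hx : ∀ (q : ℕ) (m : ℤ), act g c (.phi s q) (x j m)
      = PowerSeries.coeff q (g s j) • x j (m + q) := fun q m => by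
    rw [act_phi, x, coeff_phiAct_ι]; rfl
  have hp : ∀ q p : ℕ, act g c (.phi s q) (shift p (.phi i k))
      = PowerSeries.coeff q (g s i) • shift (p + q) (.phi i k) := fun q p => by
    rw [act_phi, coeff_phiAct_shift]; rfl
  rw [crossRel, map_sub, act_phi_mul, map_sum]
  simp only [map_smul, act_phi_mul, hx, hp]
  have hswap : ∀ l : ℕ, ∑ q ∈ Finset.HasAntidiagonal.antidiagonal t,
      (PowerSeries.coeff q.1 (g s j) • x j (m - l + q.1)) *
        PowerSeries.coeff q.2 (g s i) • shift (p + l + q.2) (.phi i k)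
      = ∑ q ∈ Finset.HasAntidiagonal.antidiagonal t,
        (PowerSeries.coeff q.1 (g s i) * PowerSeries.coeff q.2 (g s j)) •
          (x j (m + q.2 - l) * shift (p + q.1 + l) (.phi i k)) := fun l => by
    rw [← Finset.Nat.sum_antidiagonal_swap]
    refine Finset.sum_congr rfl fun q _ => ?_
    rw [Prod.fst_swap, Prod.snd_swap, smul_mul_smul_comm, mul_comm,
      show m - l + q.2 = m + q.2 - l by ring, show p + l + q.1 = p + q.1 + l by ring]
  simp only [hswap, Finset.smul_sum]
  rw [Finset.sum_comm, ← Finset.sum_sub_distrib]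
  refine Finset.sum_congr rfl fun q _ => ?_
  rw [crossRel, smul_sub, smul_mul_smul_comm, Finset.smul_sum]
  congr 1
  exact Finset.sum_congr rfl fun l _ => smul_comm _ _ _

theorem act_phiInv_crossRel (s i j : I) (k p : ℕ) (m : ℤ) :
    act g c (.phiInv s) (crossRel g i j k p m)
      = ((PowerSeries.coeff 0 (g s i))⁻¹ * (PowerSeries.coeff 0 (g s j))⁻¹) •
        crossRel g i j k p m := by
  have hx : ∀ m : ℤ, act g c (.phiInv s) (x j m)
      = (PowerSeries.coeff 0 (g s j))⁻¹ • x j m := fun m => by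
    rw [act_phiInv, phiInvAct, x, FreeAlgebra.lift_ι_apply, pairCoeff, pairSeries,
      PowerSeries.coeff_zero_C]
  have hp : ∀ p : ℕ, act g c (.phiInv s) (shift p (.phi i k))
      = (PowerSeries.coeff 0 (g s i))⁻¹ • shift p (.phi i k) := fun p => by
    rw [shift]
    split_ifs
    · rw [act_phiInv, phiInvAct, phi, FreeAlgebra.lift_ι_apply, pairCoeff, pairSeries,
        PowerSeries.coeff_zero_C]
    · rw [map_zero, smul_zero]
  rw [crossRel, map_sub, act_phiInv_mul, map_sum, hx, hp, smul_mul_smul_comm, smul_sub,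
    Finset.smul_sum]
  congr 1
  refine Finset.sum_congr rfl fun l _ => ?_
  rw [map_smul, act_phiInv_mul, hx, hp, smul_mul_smul_comm, smul_comm, mul_comm]

theorem form_crossRel (hg : ∀ i j, g i j = g j i) (i j : I) (k p : ℕ) (m : ℤ) (a : UPos I) :
    form g c a (crossRel g i j k p m) = 0 := by
  induction a using mono_induction with
  | mono w =>
    induction w generalizing p m with
    | nil => rw [mono_nil, form_one_left, counit_crossRel]
    | cons h w ih =>
      rw [mono_cons, form_mul_left, rightAct_ι]
      cases h with
      | x s M => rw [act_x_crossRel c hg, map_zero]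
      | phi s t => simp [act_phi_crossRel, ih]
      | phiInv s => rw [act_phiInv_crossRel, map_smul, ih, smul_zero]
      | qc => rw [act_qc, ih]
      | qcInv => rw [act_qcInv, ih]
  | add a a' ha ha' => rw [map_add, LinearMap.add_apply, ha, ha', add_zero]
  | smul r a ha => rw [map_smul, LinearMap.smul_apply, ha, smul_zero]

theorem form_rel {Q : I → I → ℂ} (hgQ : ∀ i j, g i j = gSeries (Q i j))
    (hg : ∀ i j, g i j = g j i) (hgg : ∀ i j, g i j * g' i j = 1) {r : UPos I} (hr : Rel Q r)
    (a : UPos I) : form g c a r = 0 := by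
  have hg0 : ∀ i j, PowerSeries.coeff 0 (g i j) ≠ 0 := fun i j =>
    left_ne_zero_of_mul_eq_one (coeff_zero_mul_of_mul_eq_one hgg i j)
  cases hr with
  | qc_central b => exact form_commutator_eq_zero c hg (act_qc g c) a b
  | qcInv_central b => exact form_commutator_eq_zero c hg (act_qcInv g c) a b
  | qc_mul_qcInv => exact form_mul_sub_one_eq_zero c hg (fun b => rfl) a
  | qcInv_mul_qc => exact form_mul_sub_one_eq_zero c hg (fun b => rfl) a
  | phi_mul_phiInv i =>
    refine form_mul_sub_one_eq_zero c hg (fun b => ?_) a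
    have := sum_act_phi_act_phi c hgg c i 0 b
    rw [Finset.HasAntidiagonal.antidiagonal_zero, Finset.sum_singleton, if_pos rfl] at this
    rw [act_phiInv_eq c hgg c, this]
  | phiInv_mul_phi i =>
    exact form_mul_sub_one_eq_zero c hg (fun b => act_phi_zero_act_phiInv c hg0 i b) a
  | phi_comm i j k l =>
    rw [form_comm c hg, map_sub, LinearMap.sub_apply, form_mul_left, form_mul_left, rightAct_phi,
      rightAct_phi, form_apply, form_apply, rightAct_phi, rightAct_phi, act_phi_act_phi_comm,
      sub_self]
  | phi_x i j k m =>
    rw [← form_crossRel c hg i j k 0 m a, crossRel, map_sub, map_sub, map_sum, map_sum,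
      Finset.Nat.sum_antidiagonal_eq_sum_range_succ_mk, shift_zero]
    congr 1
    refine Finset.sum_congr rfl fun l hl => ?_
    rw [Finset.mem_range] at hl
    rw [map_smul, map_smul, mul_assoc, form_K_mul_right c hg, gCoeff, ← hgQ, zero_add, shift.eq_2,
      if_pos (by omega)]

/-! ### The grading of the form -/

theorem shift_eq_zero_or_deg (k : ℕ) (h : PosGen I) :
    shift k h = 0 ∨ ∃ h', shift k h = FreeAlgebra.ι ℂ h' ∧ deg h' = deg h := by
  cases h <;> simp only [shift, x, phi, phiInv, qc, qcInv]
  · exact Or.inr ⟨_, rfl, rfl⟩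
  all_goals
    split_ifs
    · exact Or.inr ⟨_, rfl, rfl⟩
    · exact Or.inl rfl

theorem mono_mem_homogeneous (w : List (PosGen I)) :
    mono w ∈ homogeneous deg (w.map deg).sum :=
  Submodule.subset_span ⟨w, rfl, rfl⟩

theorem ι_mul_mem_homogeneous (h : PosGen I) {α : I → ℤ} {a : UPos I}
    (ha : a ∈ homogeneous deg α) : FreeAlgebra.ι ℂ h * a ∈ homogeneous deg (deg h + α) := by
  induction ha using Submodule.span_induction with
  | mem a ha =>
    obtain ⟨w, rfl, rfl⟩ := ha
    simpa [mono_cons] using mono_mem_homogeneous (h :: w)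
  | zero => simp
  | add a b _ _ ha hb => rw [mul_add]; exact add_mem ha hb
  | smul r a _ ha => rw [mul_smul_comm]; exact Submodule.smul_mem _ _ ha

theorem act_mem_homogeneous (g : I → I → PowerSeries ℂ) (h : PosGen I) {α : I → ℤ} {a : UPos I}
    (ha : a ∈ homogeneous deg α) : act g c h a ∈ homogeneous deg (α - deg h) := by
  induction ha using Submodule.span_induction with
  | mem a ha =>
    obtain ⟨w, rfl, rfl⟩ := ha
    induction w generalizing h with
    | nil =>
      rw [mono_nil, act_one]
      cases h with
      | x i n => simp [counit]
      | _ =>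
        rw [Algebra.algebraMap_eq_smul_one]
        exact Submodule.smul_mem _ _ (by simpa [mono_nil, deg] using mono_mem_homogeneous (I := I) [])
    | cons h' w ih =>
      obtain ⟨N, hN⟩ := act_shift_eventually g c h (mono w)
      rw [mono_cons, act_ι_mul g c h h' _ N hN]
      refine add_mem ?_ (Submodule.sum_mem _ fun k _ => Submodule.smul_mem _ _ ?_)
      · by_cases h0 : contract c h h' = 0
        · rw [h0, zero_smul]; exact zero_mem _
        have hdeg : deg h' = deg h := by
          cases h <;> cases h' <;> simp [contract] at h0
          simp [deg, h0]
        rw [List.map_cons, List.sum_cons, hdeg, add_sub_cancel_left]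
        exact Submodule.smul_mem _ _ (mono_mem_homogeneous w)
      · rcases shift_eq_zero_or_deg k h' with h0 | ⟨h1, h0, h1deg⟩
        · rw [h0, zero_mul]; exact zero_mem _
        rcases shift_eq_zero_or_deg k h with h0' | ⟨h2, h0', h2deg⟩
        · rw [h0', map_zero, LinearMap.zero_apply, mul_zero]; exact zero_mem _
        rw [h0, h0', rightAct_ι, List.map_cons, List.sum_cons, ← h1deg, ← h2deg, add_sub_assoc]
        exact ι_mul_mem_homogeneous h1 (ih h2)
  | zero => simp
  | add a b _ _ ha hb => rw [map_add]; exact add_mem ha hb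
  | smul r a _ ha => rw [map_smul]; exact Submodule.smul_mem _ _ ha

theorem counit_eq_zero_of_mem_homogeneous {α : I → ℤ} (hα : α ≠ 0) {a : UPos I}
    (ha : a ∈ homogeneous deg α) : counit a = 0 := by
  induction ha using Submodule.span_induction with
  | mem a ha =>
    obtain ⟨w, rfl, rfl⟩ := ha
    induction w with
    | nil => simp at hα
    | cons h w ih =>
      rw [mono_cons, map_mul]
      cases h with
      | x i n => simp [counit]
      | _ => rw [ih (by simpa [deg] using hα), mul_zero]
  | zero => simp
  | add a b _ _ ha hb => rw [map_add, ha, hb, add_zero]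
  | smul r a _ ha => rw [map_smul, ha, smul_zero]

theorem form_eq_zero_of_mem_homogeneous (g : I → I → PowerSeries ℂ) {α β : I → ℤ} (hαβ : α ≠ β)
    {a b : UPos I} (ha : a ∈ homogeneous deg α) (hb : b ∈ homogeneous deg β) :
    form g c a b = 0 := by
  induction ha using Submodule.span_induction with
  | mem a ha =>
    obtain ⟨w, rfl, rfl⟩ := ha
    induction w generalizing b β with
    | nil =>
      rw [mono_nil, form_one_left]
      exact counit_eq_zero_of_mem_homogeneous (Ne.symm (by simpa using hαβ)) hb
    | cons h w ih =>
      rw [mono_cons, form_mul_left, rightAct_ι]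
      refine ih (act_mem_homogeneous c g h hb) (fun h0 => hαβ ?_)
      rw [List.map_cons, List.sum_cons, h0, add_sub_cancel]
  | zero => simp
  | add a b _ _ ha hb => rw [map_add, LinearMap.add_apply, ha, hb, add_zero]
  | smul r a _ ha => rw [map_smul, LinearMap.smul_apply, ha, smul_zero]

end UPos


/-! ### Exchanging the two sides -/

section ListMap

variable {G G' : Type*}

theorem tmul_comm (a b : FreeAlgebra ℂ G) (u v : List G) : tmul a b u v = tmul b a v u :=
  mul_comm _ _

/-- If a bijection of the letters carries one coproduct to the opposite of another on letters, then
also on words. -/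
theorem comulWord_map {D : G → List G → List G → ℂ} {D' : G' → List G' → List G' → ℂ} (e : G ≃ G')
    (h : ∀ g u v, D g u v = D' (e g) (v.map e) (u.map e)) (w u v : List G) :
    comulWord D w u v = comulWord D' (w.map e) (v.map e) (u.map e) := by
  induction w generalizing u v with
  | nil =>
    classical
    simp only [comulWord, List.map_nil, tmul, ← mono_nil, coeff_mono, List.map_eq_nil_iff]
    ring
  | cons g w ih =>
    simp only [comulWord, List.map_cons, List.length_map]
    rw [Finset.sum_comm]
    refine Finset.sum_congr rfl fun i _ => Finset.sum_congr rfl fun j _ => ?_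
    rw [h, ih, List.map_take, List.map_take, List.map_drop, List.map_drop]

theorem antiWord_map {T : G → List G → ℂ} {T' : G' → List G' → ℂ} (e : G ≃ G')
    (h : ∀ g u, T g u = T' (e g) (u.map e)) (w u : List G) :
    antiWord T w u = antiWord T' (w.map e) (u.map e) := by
  induction w generalizing u with
  | nil =>
    classical
    simp only [antiWord, List.map_nil, ← mono_nil, coeff_mono, List.map_eq_nil_iff]
  | cons g w ih =>
    simp only [antiWord, List.map_cons, List.length_map]
    refine Finset.sum_congr rfl fun i _ => ?_
    rw [h, ih, List.map_take, List.map_drop]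

end ListMap

theorem zpowWith_neg {R : Type*} [Monoid R] (a b : R) (e : ℤ) :
    zpowWith a b (-e) = zpowWith b a e := by
  rcases e with (_ | n) | n
  · simp [zpowWith]
  · rfl
  · rfl

namespace UNeg

variable {I : Type*}

/-- The bijection between the letters of the two sides: `x⁻_{i,n}` goes to `x⁺_{i,-n}`, `ψ_{i,k}`
to `φ_{i,-k}` and `q^{c'/2}` to `q^{-c/2}`. It carries `Δ₋` to the opposite of `Δ₊` and `S` to
`S⁻¹`. -/
def genEquiv : NegGen I ≃ PosGen I where
  toFun
    | .x i n => .x i (-n)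
    | .psi i k => .phi i k
    | .psiInv i => .phiInv i
    | .qc => .qcInv
    | .qcInv => .qc
  invFun
    | .x i n => .x i (-n)
    | .phi i k => .psi i k
    | .phiInv i => .psiInv i
    | .qc => .qcInv
    | .qcInv => .qc
  left_inv h := by cases h <;> simp
  right_inv h := by cases h <;> simp

/-- The isomorphism of free algebras given by `genEquiv`. -/
def toPos : UNeg I →ₐ[ℂ] UPos I := FreeAlgebra.lift ℂ fun h => FreeAlgebra.ι ℂ (genEquiv h)

theorem toPos_ι (h : NegGen I) : toPos (FreeAlgebra.ι ℂ h) = FreeAlgebra.ι ℂ (genEquiv h) := by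
  simp [toPos]

theorem toPos_x (i : I) (n : ℤ) : toPos (x i n) = UPos.x i (-n) := toPos_ι _

theorem toPos_psi (i : I) (k : ℕ) : toPos (psi i k) = UPos.phi i k := toPos_ι _

theorem toPos_psiInv (i : I) : toPos (psiInv i) = UPos.phiInv i := toPos_ι _

theorem toPos_qc : toPos (qc : UNeg I) = UPos.qcInv := toPos_ι _

theorem toPos_qcInv : toPos (qcInv : UNeg I) = UPos.qc := toPos_ι _

theorem toPos_K (e : ℤ) : toPos (K e : UNeg I) = UPos.K (-e) := by
  rw [UPos.K, zpowWith_neg, K]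
  cases e <;> simp [zpowWith, toPos_qc, toPos_qcInv]

theorem toPos_psiS (i : I) (k : ℕ) : toPos (psiS i k) = UPos.phiS i k := by
  induction k using Nat.strong_induction_on with
  | _ k ih =>
    cases k with
    | zero => rw [psiS, invCoeff, UPos.phiS, invCoeff, toPos_psiInv]
    | succ n =>
      rw [psiS, invCoeff, UPos.phiS, invCoeff, map_neg, map_mul, toPos_psiInv, map_sum]
      congr 2
      refine Finset.sum_congr rfl fun s _ => ?_
      rw [map_mul, toPos_psi]
      congr 1
      exact ih s (by omega)

theorem toPos_mono (w : List (NegGen I)) : toPos (mono w) = mono (w.map genEquiv) := by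
  induction w with
  | nil => simp [mono_nil]
  | cons h w ih => rw [mono_cons, map_mul, ih, toPos_ι, List.map_cons, mono_cons]

theorem coeff_toPos (b : UNeg I) (w : List (NegGen I)) :
    coeff (toPos b) (w.map genEquiv) = coeff b w := by
  classical
  induction b using mono_induction with
  | mono v =>
    rw [toPos_mono, coeff_mono, coeff_mono]
    simp only [(List.map_injective_iff.2 genEquiv.injective).eq_iff]
  | add a b ha hb => rw [map_add, coeff_add, coeff_add, ha, hb]
  | smul r a ha => rw [map_smul, coeff_smul, coeff_smul, ha]

theorem tmul_toPos (a b : UNeg I) (u v : List (NegGen I)) :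
    tmul (toPos a) (toPos b) (u.map genEquiv) (v.map genEquiv) = tmul a b u v := by
  rw [tmul, coeff_toPos, coeff_toPos, tmul]

theorem counit_toPos (b : UNeg I) : UPos.counit (toPos b) = counit b := by
  have h : UPos.counit.comp toPos = (counit : UNeg I →ₐ[ℂ] ℂ) := by
    ext h
    cases h <;> simp [UPos.counit, counit, toPos_ι, genEquiv]
  exact DFunLike.congr_fun h b

theorem comulGen_eq (h : NegGen I) (u v : List (NegGen I)) :
    comulGen h u v = UPos.comulGen (genEquiv h) (v.map genEquiv) (u.map genEquiv) := by
  cases h with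
  | x i n =>
    change _ = UPos.comulGen (.x i (-n)) _ _
    simp only [comulGen, UPos.comulGen, ← tmul_toPos, map_mul, map_one, toPos_x, toPos_psi, toPos_K]
    rw [tmul_comm]
    congr 1
    refine finsum_congr fun k => ?_
    rw [tmul_comm]
    ring_nf
  | psi i k =>
    change _ = UPos.comulGen (.phi i k) _ _
    simp only [comulGen, UPos.comulGen, ← tmul_toPos, map_mul, toPos_psi, toPos_K, neg_neg]
    rw [← Finset.Nat.sum_antidiagonal_swap]
    exact Finset.sum_congr rfl fun p _ => tmul_comm _ _ _ _
  | psiInv i =>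
    change _ = UPos.comulGen (.phiInv i) _ _
    rw [comulGen, UPos.comulGen, ← tmul_toPos, toPos_psiInv, tmul_comm]
  | qc =>
    change _ = UPos.comulGen .qcInv _ _
    rw [comulGen, UPos.comulGen, ← tmul_toPos, toPos_qc, tmul_comm]
  | qcInv =>
    change _ = UPos.comulGen .qc _ _
    rw [comulGen, UPos.comulGen, ← tmul_toPos, toPos_qcInv, tmul_comm]

theorem comul_eq (b : UNeg I) (u v : List (NegGen I)) :
    comul b u v = UPos.comul (toPos b) (v.map genEquiv) (u.map genEquiv) := by
  induction b using mono_induction with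
  | mono w =>
    rw [comul, comulExt_mono, UPos.comul, toPos_mono, comulExt_mono,
      comulWord_map genEquiv comulGen_eq]
  | add a b ha hb => simp only [comul, UPos.comul, map_add, comulExt_add] at ha hb ⊢; rw [ha, hb]
  | smul r a ha => simp only [comul, UPos.comul, map_smul, comulExt_smul] at ha ⊢; rw [ha]

theorem antipodeGen_eq (h : NegGen I) (u : List (NegGen I)) :
    antipodeGen h u = UPos.antipodeInvGen (genEquiv h) (u.map genEquiv) := by
  cases h with
  | x i n =>
    change _ = UPos.antipodeInvGen (.x i (-n)) _
    simp only [antipodeGen, UPos.antipodeInvGen, ← coeff_toPos, map_neg, map_mul, toPos_x,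
      toPos_psiS, toPos_K]
    refine finsum_congr fun k => ?_
    ring_nf
  | psi i k =>
    change _ = UPos.antipodeInvGen (.phi i k) _
    rw [antipodeGen, UPos.antipodeInvGen, ← coeff_toPos, toPos_psiS]
  | psiInv i =>
    change _ = UPos.antipodeInvGen (.phiInv i) _
    rw [antipodeGen, UPos.antipodeInvGen, ← coeff_toPos, toPos_psi]
  | qc =>
    change _ = UPos.antipodeInvGen .qcInv _
    rw [antipodeGen, UPos.antipodeInvGen, ← coeff_toPos, toPos_qcInv]
  | qcInv =>
    change _ = UPos.antipodeInvGen .qc _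
    rw [antipodeGen, UPos.antipodeInvGen, ← coeff_toPos, toPos_qc]

theorem antipode_eq (b : UNeg I) (u : List (NegGen I)) :
    antipode b u = UPos.antipodeInv (toPos b) (u.map genEquiv) := by
  induction b using mono_induction with
  | mono w =>
    rw [antipode, antiExt_mono, UPos.antipodeInv, toPos_mono, antiExt_mono,
      antiWord_map genEquiv antipodeGen_eq]
  | add a b ha hb =>
    simp only [antipode, UPos.antipodeInv, map_add, antiExt_add] at ha hb ⊢; rw [ha, hb]
  | smul r a ha => simp only [antipode, UPos.antipodeInv, map_smul, antiExt_smul] at ha ⊢; rw [ha]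

theorem toPos_rel {Q : I → I → ℂ} {r : UNeg I} (hr : Rel Q r) : UPos.Rel Q (toPos r) := by
  cases hr with
  | qc_central b => simpa [toPos_qc] using UPos.Rel.qcInv_central (Q := Q) (toPos b)
  | qcInv_central b => simpa [toPos_qcInv] using UPos.Rel.qc_central (Q := Q) (toPos b)
  | qc_mul_qcInv => simpa [toPos_qc, toPos_qcInv] using UPos.Rel.qcInv_mul_qc (Q := Q)
  | qcInv_mul_qc => simpa [toPos_qc, toPos_qcInv] using UPos.Rel.qc_mul_qcInv (Q := Q)
  | psi_mul_psiInv i =>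
    simpa [toPos_psi, toPos_psiInv] using UPos.Rel.phi_mul_phiInv (Q := Q) i
  | psiInv_mul_psi i =>
    simpa [toPos_psi, toPos_psiInv] using UPos.Rel.phiInv_mul_phi (Q := Q) i
  | psi_comm i j k l => simpa [toPos_psi] using UPos.Rel.phi_comm (Q := Q) i j k l
  | psi_x i j k m =>
    have h : ∀ p : ℕ, -(m + (p : ℤ)) = -m - p := fun p => by ring
    have := UPos.Rel.phi_x (Q := Q) i j k (-m)
    simpa only [map_sub, map_sum, map_smul, map_mul, toPos_psi, toPos_x, toPos_K, h] using this

variable [DecidableEq I]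

theorem deg_genEquiv (h : NegGen I) : UPos.deg (genEquiv h) = -deg h := by
  cases h <;> simp [genEquiv, UPos.deg, deg]

theorem toPos_mem_homogeneous {β : I → ℤ} {b : UNeg I} (hb : b ∈ homogeneous deg β) :
    toPos b ∈ homogeneous UPos.deg (-β) := by
  induction hb using Submodule.span_induction with
  | mem b hb =>
    obtain ⟨w, rfl, rfl⟩ := hb
    have hw : -(w.map deg).sum = ((w.map genEquiv).map UPos.deg).sum := by
      induction w with
      | nil => simp
      | cons h w ih =>
        simp only [List.map_cons, List.sum_cons, neg_add, ih, deg_genEquiv]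
    rw [toPos_mono, hw]
    exact UPos.mono_mem_homogeneous _
  | zero => simp
  | add a b _ _ ha hb => rw [map_add]; exact add_mem ha hb
  | smul r a _ ha => rw [map_smul]; exact Submodule.smul_mem _ _ ha

end UNeg

/-! ### The pairing -/

section ThePairing

variable {I : Type*} [DecidableEq I] {g g' : I → I → PowerSeries ℂ} (c : ℂ)

/-- The pairing of the two sides which the bijection of letters makes out of the form. -/
def pairing (g : I → I → PowerSeries ℂ) : UPos I →ₗ[ℂ] UNeg I →ₗ[ℂ] ℂ :=
  (UPos.form g c).compl₂ UNeg.toPos.toLinearMap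

theorem pairing_apply (a : UPos I) (b : UNeg I) :
    pairing c g a b = UPos.form g c a (UNeg.toPos b) := rfl

theorem isWeakHopfPairing_pairing (hg : ∀ i j, g i j = g j i) (hgg : ∀ i j, g i j * g' i j = 1) :
    IsWeakHopfPairing (pairing c g) := by
  let eL : List (NegGen I) ≃ List (PosGen I) := Equiv.listEquivOfEquiv UNeg.genEquiv
  let eP : List (NegGen I) × List (NegGen I) ≃ List (PosGen I) × List (PosGen I) :=
    (Equiv.prodComm _ _).trans (Equiv.prodCongr eL eL)
  have hleft : ∀ (a a' : UPos I) (b : UNeg I) (p : List (NegGen I) × List (NegGen I)),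
      UNeg.comul b p.1 p.2 * (pairing c g a (mono p.2) * pairing c g a' (mono p.1))
        = UPos.comul (UNeg.toPos b) (eP p).1 (eP p).2 *
          (UPos.form g c (mono (eP p).1) a * UPos.form g c (mono (eP p).2) a') := by
    intro a a' b p
    rw [UNeg.comul_eq, pairing_apply, pairing_apply, UNeg.toPos_mono, UNeg.toPos_mono,
      UPos.form_comm c hg a, UPos.form_comm c hg a']
    rfl
  have hanti : ∀ (a : UPos I) (b : UNeg I) (v : List (NegGen I)),
      UNeg.antipode b v * pairing c g a (mono v)
        = UPos.antipodeInv (UNeg.toPos b) (eL v) * UPos.form g c a (mono (eL v)) := by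
    intro a b v
    rw [UNeg.antipode_eq, pairing_apply, UNeg.toPos_mono]
    rfl
  refine ⟨?_, ?_, ?_, ?_, ?_, ?_, ?_, ?_, ?_⟩
  · exact fun a b b' => (UPos.form_mul_right_eq_finsum g c a _ _).1
  · intro a b b'
    rw [pairing_apply, map_mul]
    exact (UPos.form_mul_right_eq_finsum g c a _ _).2
  · intro a a' b
    simp only [hleft]
    exact (UPos.form_mul_right_eq_finsum g c _ a a').1.preimage eP.injective.injOn
  · intro a a' b
    simp only [hleft]
    rw [pairing_apply, UPos.form_comm c hg, (UPos.form_mul_right_eq_finsum g c _ a a').2]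
    exact (finsum_comp_equiv eP).symm
  · intro a
    rw [pairing_apply, map_one, UPos.form_one_right]
  · intro b
    rw [pairing_apply, UPos.form_one_left, UNeg.counit_toPos]
  · exact fun a b => (UPos.form_antipodeInv c hgg a _).1
  · intro a b
    simp only [hanti, UPos.form_comm c hg a]
    exact (UPos.form_antipodeInv c hgg _ a).1.preimage eL.injective.injOn
  · intro a b
    simp only [hanti]
    exact (UPos.form_antipodeInv_comm c hg hgg a _).trans
      (finsum_comp_equiv eL (f := fun u => UPos.antipodeInv (UNeg.toPos b) u *
        UPos.form g c a (mono u))).symm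

theorem isQGraded_pairing (g : I → I → PowerSeries ℂ) : IsQGraded (pairing c g) := by
  intro α β hαβ a ha b hb
  refine UPos.form_eq_zero_of_mem_homogeneous c g (fun h => hαβ ?_) ha
    (UNeg.toPos_mem_homogeneous hb)
  rw [h, neg_add_cancel]

end ThePairing


/-! ### The values on letters -/

theorem constantCoeff_gSeries {a : ℂ} (ha : a ≠ 0) :
    PowerSeries.constantCoeff (gSeries a) ≠ 0 := by
  simp [gSeries, ha]

section Values

variable {I : Type*} [DecidableEq I] {g : I → I → PowerSeries ℂ}

theorem hasPrescribedValues_pairing {q : ℂ} {Q : I → I → ℂ}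
    (hgQ : ∀ i j, g i j = gSeries (Q i j)) (hg : ∀ i j, g i j = g j i) :
    HasPrescribedValues q Q (pairing (-1 / (q + q⁻¹)) g) := by
  set c : ℂ := -1 / (q + q⁻¹)
  have hl : ∀ (h : PosGen I) (b : UNeg I), pairing c g (FreeAlgebra.ι ℂ h) b
      = UPos.counit (UPos.act g c h (UNeg.toPos b)) := fun h b => by
    rw [pairing_apply, UPos.form_apply, rightAct_ι]
  have hr : ∀ (a : UPos I) (h : NegGen I), pairing c g a (FreeAlgebra.ι ℂ h)
      = UPos.counit (UPos.act g c (UNeg.genEquiv h) a) := fun a h => by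
    rw [pairing_apply, UPos.form_comm c hg, UPos.form_apply, UNeg.toPos_ι, rightAct_ι]
  have hgc : ∀ i j k, PowerSeries.coeff k (g i j) = gCoeff Q i j k := fun i j k => by
    rw [gCoeff, hgQ]
  have hphi : ∀ i k h, UPos.act g c (.phi i k) (FreeAlgebra.ι ℂ h)
      = UPos.pairCoeff g (.phi i 0) h k • UPos.shift k h := fun i k h => by
    rw [UPos.act_phi, UPos.coeff_phiAct_ι]
  have hphiInv : ∀ i h, UPos.act g c (.phiInv i) (FreeAlgebra.ι ℂ h)
      = UPos.pairCoeff g (.phiInv i) h 0 • FreeAlgebra.ι ℂ h := fun i h => by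
    rw [UPos.act_phiInv, UPos.phiInvAct, FreeAlgebra.lift_ι_apply]
  have hqc : ∀ b, pairing c g UPos.qc b = UPos.counit (UNeg.toPos b) := fun b => hl _ b
  have hqcInv : ∀ b, pairing c g UPos.qcInv b = UPos.counit (UNeg.toPos b) := fun b => hl _ b
  have hqc' : ∀ a, pairing c g a UNeg.qc = UPos.counit a := fun a => hr a _
  have hqcInv' : ∀ a, pairing c g a UNeg.qcInv = UPos.counit a := fun a => hr a _
  constructor
  case phi_x =>
    intro i k j n
    rw [UPos.phi, hl, UNeg.toPos_x, UPos.x, hphi, map_smul]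
    simp [UPos.shift, UPos.counit, UPos.x]
  case x_psi =>
    intro j n i k
    rw [UPos.x, hl, UNeg.toPos_psi, UPos.phi, UPos.act_x, UPos.xAct_ι]
    simp [UPos.contract]
  case phi_psi =>
    intro i j l k
    rw [UPos.phi, hl, UNeg.toPos_psi, UPos.phi, hphi, map_smul, UPos.shift, UPos.pairCoeff,
      UPos.pairSeries, hgc]
    rcases lt_trichotomy k l with h | rfl | h
    · rw [if_neg (by omega), if_neg (by omega), map_zero, smul_zero]
    · simp [UPos.counit, UPos.phi]
    · rw [if_pos (by omega), if_neg (by omega)]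
      simp only [UPos.counit, UPos.phi, FreeAlgebra.lift_ι_apply]
      rw [if_neg (by omega), smul_zero]
  case phiInv_psi =>
    intro i j
    rw [UPos.phiInv, hl, UNeg.toPos_psi, UPos.phi, hphiInv, map_smul, UPos.pairCoeff,
      UPos.pairSeries, hgc, PowerSeries.coeff_zero_C]
    simp [UPos.counit]
  case phi_psiInv =>
    intro i j
    rw [UPos.phi, hl, UNeg.toPos_psiInv, UPos.phiInv, hphi, map_smul, UPos.pairCoeff,
      UPos.pairSeries, hgc, PowerSeries.coeff_zero_C, UPos.shift_zero]
    simp [UPos.counit]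
  case x_x =>
    intro i j n m
    rw [UPos.x, hl, UNeg.toPos_x, UPos.x, UPos.act_x, UPos.xAct_ι, UPos.contract]
    simp only [AlgHom.commutes, Algebra.algebraMap_self, RingHom.id_apply]
    rfl
  all_goals
    intros
    simp only [hqc, hqcInv, hqc', hqcInv', UNeg.counit_toPos]
    simp [UPos.counit, UNeg.counit, UNeg.qc, UNeg.qcInv, UPos.phi, UPos.phiInv,
      UPos.x, UNeg.psi, UNeg.psiInv, UNeg.x]

end Values

/-! ### Uniqueness -/

theorem comulExt_ι {G : Type*} (D : G → List G → List G → ℂ) (h : G) (u v : List G) :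
    comulExt D (FreeAlgebra.ι ℂ h) u v = D h u v := by
  classical
  rw [← mono_singleton, comulExt_mono]
  simp only [comulWord]
  have hz : ∀ i j, (i, j) ≠ (u.length, v.length) → i ∈ Finset.range (u.length + 1) →
      j ∈ Finset.range (v.length + 1) →
      tmul (1 : FreeAlgebra ℂ G) 1 (u.drop i) (v.drop j) = 0 := by
    intro i j hij hi hj
    rw [Finset.mem_range] at hi hj
    rw [tmul, ← mono_nil, coeff_mono, coeff_mono]
    simp only [List.drop_eq_nil_iff]
    by_cases h1 : u.length ≤ i
    · rw [if_neg (c := v.length ≤ j), mul_zero]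
      exact fun h2 => hij (Prod.ext (by simp; omega) (by simp; omega))
    · rw [if_neg h1, zero_mul]
  rw [Finset.sum_eq_single_of_mem u.length (by simp), Finset.sum_eq_single_of_mem v.length (by simp)]
  · simp [tmul, ← mono_nil, coeff_mono]
  · intro j hj hj'
    rw [hz _ _ (by simpa using hj') (by simp) hj, mul_zero]
  · intro i hi hi'
    refine Finset.sum_eq_zero fun j hj => ?_
    rw [hz _ _ (by simp [hi']) hi hj, mul_zero]

theorem antiExt_ι {G : Type*} (T : G → List G → ℂ) (h : G) (u : List G) :
    antiExt T (FreeAlgebra.ι ℂ h) u = T h u := by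
  classical
  rw [← mono_singleton, antiExt_mono]
  simp only [antiWord]
  rw [Finset.sum_eq_single_of_mem 0 (by simp)]
  · simp [← mono_nil, coeff_mono]
  · intro i hi hi'
    rw [Finset.mem_range] at hi
    rw [← mono_nil, coeff_mono, if_neg, zero_mul]
    rw [List.take_eq_nil_iff]
    rintro (h0 | rfl)
    · exact hi' h0
    · simp at hi; omega

theorem finsum_coeff_mul {G : Type*} (f : FreeAlgebra ℂ G →ₗ[ℂ] ℂ) (a : FreeAlgebra ℂ G) :
    ∑ᶠ u : List G, coeff a u * f (mono u) = f a := finsum_coeff_smul f a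

theorem finsum_tmul_mul {G : Type*} (f f' : FreeAlgebra ℂ G →ₗ[ℂ] ℂ) (a a' : FreeAlgebra ℂ G) :
    ∑ᶠ p : List G × List G, tmul a a' p.1 p.2 * (f (mono p.1) * f' (mono p.2)) = f a * f' a' :=
  (finsum_tmul_smul f f' a a').2

/-- A multiplicative functional that vanishes on the higher coefficients of an inverse series
vanishes on the higher coefficients of the series. -/
theorem map_eq_zero_of_map_invCoeff {R : Type*} [Ring R] [Algebra ℂ R] (f : R →ₗ[ℂ] ℂ)
    (hf : ∀ a b, f (a * b) = f a * f b) (s : ℕ → R) (b : R) (hb : f b ≠ 0)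
    (hs : ∀ n, f (invCoeff s b (n + 1)) = 0) (n : ℕ) : f (s (n + 1)) = 0 := by
  have h := hs n
  rw [invCoeff, map_neg, hf, map_sum, Fin.sum_univ_succ, Finset.sum_eq_zero (s := Finset.univ),
    add_zero, neg_eq_zero, mul_eq_zero, or_iff_right hb, hf] at h
  · simpa [invCoeff, hb] using h
  · intro i _
    rw [hf, Fin.val_succ, hs, mul_zero]

section Uniqueness

variable {I : Type*} {P P' : UPos I →ₗ[ℂ] UNeg I →ₗ[ℂ] ℂ}

theorem IsWeakHopfPairing.map_mul_of_groupLike (hP : IsWeakHopfPairing P) {h : PosGen I}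
    (hh : ∀ u v, UPos.comulGen h u v = tmul (FreeAlgebra.ι ℂ h) (FreeAlgebra.ι ℂ h) u v)
    (b b' : UNeg I) : P (FreeAlgebra.ι ℂ h) (b * b')
      = P (FreeAlgebra.ι ℂ h) b * P (FreeAlgebra.ι ℂ h) b' := by
  rw [hP.map_mul_right]
  simp only [UPos.comul, comulExt_ι, hh]
  exact finsum_tmul_mul (P.flip b) (P.flip b') _ _

theorem IsWeakHopfPairing.map_mul_psiInv (hP : IsWeakHopfPairing P) (j : I) (a a' : UPos I) :
    P (a * a') (UNeg.psiInv j) = P a (UNeg.psiInv j) * P a' (UNeg.psiInv j) := by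
  rw [hP.map_mul_left, mul_comm, UNeg.psiInv, ← finsum_tmul_mul (P a') (P a)]
  simp only [UNeg.comul, comulExt_ι, UNeg.comulGen]
  refine finsum_congr fun p => ?_
  rw [mul_comm (P a _)]
  rfl

theorem IsWeakHopfPairing.eq_counit_of_groupLike (hP : IsWeakHopfPairing P) {h : PosGen I}
    (hh : ∀ u v, UPos.comulGen h u v = tmul (FreeAlgebra.ι ℂ h) (FreeAlgebra.ι ℂ h) u v)
    (h1 : UPos.counit (FreeAlgebra.ι ℂ h) = 1)
    (hv : ∀ h', P (FreeAlgebra.ι ℂ h) (FreeAlgebra.ι ℂ h') = UNeg.counit (FreeAlgebra.ι ℂ h'))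
    (b : UNeg I) : P (FreeAlgebra.ι ℂ h) b = UNeg.counit b := by
  induction b using mono_induction with
  | mono w =>
    induction w with
    | nil => rw [mono_nil, hP.map_one_right, h1, map_one]
    | cons h' w ih => rw [mono_cons, hP.map_mul_of_groupLike hh, hv, ih, map_mul]
  | add a b ha hb => rw [map_add, map_add, ha, hb]
  | smul r a ha => rw [map_smul, map_smul, ha]

/-- Right multiplication by an element that pairs like `1` does not change the pairing. -/
theorem IsWeakHopfPairing.map_mul_of_eq_counit (hP : IsWeakHopfPairing P) {k : UPos I}
    (hk : ∀ b, P k b = UNeg.counit b) (a : UPos I) (b : UNeg I) : P (a * k) b = P a b := by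
  conv_rhs => rw [← mul_one a]
  rw [hP.map_mul_left, hP.map_mul_left]
  simp only [hk, hP.map_one_left]

variable [DecidableEq I] {q : ℂ} {Q : I → I → ℂ}

theorem HasPrescribedValues.eq_counit_qc (hV : HasPrescribedValues q Q P)
    (hP : IsWeakHopfPairing P) (b : UNeg I) :
    P UPos.qc b = UNeg.counit b ∧ P UPos.qcInv b = UNeg.counit b := by
  constructor
  · refine hP.eq_counit_of_groupLike (fun _ _ => rfl) (by simp [UPos.counit]) (fun h' => ?_) b
    cases h' with
    | x i n => exact (hV.qc_x i n).trans (by simp [UNeg.counit])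
    | psi i k => exact (hV.qc_psi i k).trans (by simp [UNeg.counit])
    | psiInv i => exact (hV.qc_psiInv i).trans (by simp [UNeg.counit])
    | qc => exact hV.qc_qc.trans (by simp [UNeg.counit])
    | qcInv => exact hV.qc_qcInv.trans (by simp [UNeg.counit])
  · refine hP.eq_counit_of_groupLike (fun _ _ => rfl) (by simp [UPos.counit]) (fun h' => ?_) b
    cases h' with
    | x i n => exact (hV.qcInv_x i n).trans (by simp [UNeg.counit])
    | psi i k => exact (hV.qcInv_psi i k).trans (by simp [UNeg.counit])
    | psiInv i => exact (hV.qcInv_psiInv i).trans (by simp [UNeg.counit])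
    | qc => exact hV.qcInv_qc.trans (by simp [UNeg.counit])
    | qcInv => exact hV.qcInv_qcInv.trans (by simp [UNeg.counit])

theorem HasPrescribedValues.map_mul_K (hV : HasPrescribedValues q Q P)
    (hP : IsWeakHopfPairing P) (e : ℤ) (a : UPos I) (b : UNeg I) :
    P (a * UPos.K e) b = P a b := by
  have h : ∀ n : ℕ, P (a * UPos.qc ^ n) b = P a b ∧ P (a * UPos.qcInv ^ n) b = P a b := by
    intro n
    induction n with
    | zero => simp
    | succ n ih =>
      rw [pow_succ, pow_succ, ← mul_assoc, ← mul_assoc,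
        hP.map_mul_of_eq_counit fun b => (hV.eq_counit_qc hP b).1,
        hP.map_mul_of_eq_counit fun b => (hV.eq_counit_qc hP b).2]
      exact ih
  cases e with
  | ofNat n => exact (h n).1
  | negSucc n => exact (h (n + 1)).2

theorem IsQGraded.x_psiInv (hG : IsQGraded P) (i j : I) (n : ℤ) :
    P (UPos.x i n) (UNeg.psiInv j) = 0 := by
  refine hG (Pi.single i 1) 0 (by simp) _ (Submodule.subset_span ⟨[.x i n], ?_, ?_⟩) _
    (Submodule.subset_span ⟨[.psiInv j], ?_, ?_⟩)
  · simp [UPos.deg]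
  · rw [mono_singleton]; rfl
  · simp [UNeg.deg]
  · rw [mono_singleton]; rfl

theorem IsQGraded.phiInv_x (hG : IsQGraded P) (i j : I) (n : ℤ) :
    P (UPos.phiInv i) (UNeg.x j n) = 0 := by
  refine hG 0 (-Pi.single j 1) (by simp) _ (Submodule.subset_span ⟨[.phiInv i], ?_, ?_⟩) _
    (Submodule.subset_span ⟨[.x j n], ?_, ?_⟩)
  · simp [UPos.deg]
  · rw [mono_singleton]; rfl
  · simp [UNeg.deg]
  · rw [mono_singleton]; rfl

omit [DecidableEq I] in
theorem IsWeakHopfPairing.antipode_phiInv_psi (hP : IsWeakHopfPairing P) (i j : I) (k : ℕ) :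
    P (UPos.phi i 0) (UNeg.psi j k) = P (UPos.phiInv i) (UNeg.psiS j k) := by
  have h := hP.map_antipode (UPos.phiInv i) (UNeg.psi j k)
  simp only [UPos.phiInv, UNeg.psi, UPos.antipodeInv, UNeg.antipode, antiExt_ι, UPos.antipodeInvGen,
    UNeg.antipodeGen] at h
  exact ((finsum_coeff_mul (P.flip (UNeg.psi j k)) _).symm.trans h).trans (finsum_coeff_mul _ _)

omit [DecidableEq I] in
theorem IsWeakHopfPairing.antipode_phi_psiInv (hP : IsWeakHopfPairing P) (i j : I) (k : ℕ) :
    P (UPos.phiS i k) (UNeg.psiInv j) = P (UPos.phi i k) (UNeg.psi j 0) := by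
  have h := hP.map_antipode (UPos.phi i k) (UNeg.psiInv j)
  simp only [UPos.phi, UNeg.psiInv, UPos.antipodeInv, UNeg.antipode, antiExt_ι, UPos.antipodeInvGen,
    UNeg.antipodeGen] at h
  exact ((finsum_coeff_mul (P.flip (UNeg.psiInv j)) _).symm.trans h).trans (finsum_coeff_mul _ _)

theorem HasPrescribedValues.phiInv_psiInv (hV : HasPrescribedValues q Q P)
    (hP : IsWeakHopfPairing P) (i j : I) :
    P (UPos.phiInv i) (UNeg.psiInv j) = gCoeff Q i j 0 := by
  have h := hP.antipode_phiInv_psi i j 0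
  rw [hV.phi_psi, if_pos rfl, UNeg.psiS, invCoeff] at h
  exact h.symm

theorem HasPrescribedValues.phiInv_psi_succ (hV : HasPrescribedValues q Q P)
    (hP : IsWeakHopfPairing P) (hQ : ∀ i j, gCoeff Q i j 0 ≠ 0) (i j : I) (k : ℕ) :
    P (UPos.phiInv i) (UNeg.psi j (k + 1)) = 0 := by
  refine map_eq_zero_of_map_invCoeff (P (UPos.phiInv i))
    (hP.map_mul_of_groupLike (h := .phiInv i) fun _ _ => rfl) (UNeg.psi j) (UNeg.psiInv j) ?_
    (fun n => ?_) k
  · rw [hV.phiInv_psiInv hP]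
    exact hQ i j
  · exact (hP.antipode_phiInv_psi i j (n + 1)).symm.trans
      ((hV.phi_psi _ _ _ _).trans (if_neg (by omega)))

theorem HasPrescribedValues.phi_succ_psiInv (hV : HasPrescribedValues q Q P)
    (hP : IsWeakHopfPairing P) (hQ : ∀ i j, gCoeff Q i j 0 ≠ 0) (i j : I) (k : ℕ) :
    P (UPos.phi i (k + 1)) (UNeg.psiInv j) = 0 := by
  refine map_eq_zero_of_map_invCoeff (P.flip (UNeg.psiInv j))
    (hP.map_mul_psiInv j) (UPos.phi i) (UPos.phiInv i) ?_ (fun n => ?_) k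
  · rw [LinearMap.flip_apply, hV.phiInv_psiInv hP]
    exact hQ i j
  · exact (hP.antipode_phi_psiInv i j (n + 1)).trans
      ((hV.phi_psi _ _ _ _).trans (if_neg (by omega)))

/-- The prescribed values, the grading and the antipode determine the pairing of any two letters. -/
theorem pairing_ι_ι_unique (hP : IsWeakHopfPairing P) (hP' : IsWeakHopfPairing P')
    (hG : IsQGraded P) (hG' : IsQGraded P') (hV : HasPrescribedValues q Q P)
    (hV' : HasPrescribedValues q Q P') (hQ : ∀ i j, gCoeff Q i j 0 ≠ 0) (h : PosGen I)
    (h' : NegGen I) : P (FreeAlgebra.ι ℂ h) (FreeAlgebra.ι ℂ h')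
      = P' (FreeAlgebra.ι ℂ h) (FreeAlgebra.ι ℂ h') := by
  cases h with
  | x i n =>
    cases h' with
    | x j m => exact (hV.x_x i j n m).trans (hV'.x_x i j n m).symm
    | psi j k => exact (hV.x_psi i n j k).trans (hV'.x_psi i n j k).symm
    | psiInv j => exact (hG.x_psiInv i j n).trans (hG'.x_psiInv i j n).symm
    | qc => exact (hV.x_qc i n).trans (hV'.x_qc i n).symm
    | qcInv => exact (hV.x_qcInv i n).trans (hV'.x_qcInv i n).symm
  | phi i k =>
    cases h' with
    | x j m => exact (hV.phi_x i k j m).trans (hV'.phi_x i k j m).symm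
    | psi j l => exact (hV.phi_psi i j k l).trans (hV'.phi_psi i j k l).symm
    | psiInv j =>
      cases k with
      | zero => exact (hV.phi_psiInv i j).trans (hV'.phi_psiInv i j).symm
      | succ k =>
        exact (hV.phi_succ_psiInv hP hQ i j k).trans
          (hV'.phi_succ_psiInv hP' hQ i j k).symm
    | qc => exact (hV.phi_qc i k).trans (hV'.phi_qc i k).symm
    | qcInv => exact (hV.phi_qcInv i k).trans (hV'.phi_qcInv i k).symm
  | phiInv i =>
    cases h' with
    | x j m => exact (hG.phiInv_x i j m).trans (hG'.phiInv_x i j m).symm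
    | psi j k =>
      cases k with
      | zero => exact (hV.phiInv_psi i j).trans (hV'.phiInv_psi i j).symm
      | succ k =>
        exact (hV.phiInv_psi_succ hP hQ i j k).trans
          (hV'.phiInv_psi_succ hP' hQ i j k).symm
    | psiInv j => exact (hV.phiInv_psiInv hP i j).trans (hV'.phiInv_psiInv hP' i j).symm
    | qc => exact (hV.phiInv_qc i).trans (hV'.phiInv_qc i).symm
    | qcInv => exact (hV.phiInv_qcInv i).trans (hV'.phiInv_qcInv i).symm
  | qc =>
    exact (hV.eq_counit_qc hP _).1.trans (hV'.eq_counit_qc hP' _).1.symm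
  | qcInv =>
    exact (hV.eq_counit_qc hP _).2.trans (hV'.eq_counit_qc hP' _).2.symm

omit [DecidableEq I] in
theorem UPos.exists_ι_mul_K_eq_mono (h : PosGen I) (e : ℤ) :
    ∃ w, FreeAlgebra.ι ℂ h * UPos.K e = mono w := by
  have hpow : ∀ (g : PosGen I) (n : ℕ), FreeAlgebra.ι ℂ g ^ n = mono (List.replicate n g) :=
    fun g n => by simp [mono]
  cases e with
  | ofNat n =>
    exact ⟨h :: List.replicate n .qc, by rw [mono_cons, ← hpow]; rfl⟩
  | negSucc n =>
    exact ⟨h :: List.replicate (n + 1) .qcInv, by rw [mono_cons, ← hpow]; rfl⟩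

omit [DecidableEq I] in
theorem UPos.mono_eq_of_coeff_ne_zero {h : PosGen I} {e : ℤ} {u : List (PosGen I)}
    (hu : coeff (FreeAlgebra.ι ℂ h * UPos.K e) u ≠ 0) : mono u = FreeAlgebra.ι ℂ h * UPos.K e := by
  classical
  obtain ⟨w, hw⟩ := UPos.exists_ι_mul_K_eq_mono h e
  rw [hw, coeff_mono] at hu
  rw [hw]
  by_contra h0
  exact hu (if_neg fun h1 => h0 (by rw [h1]))

omit [DecidableEq I] in
/-- The words in the coproduct of a letter are empty or, up to the central letters, letters. -/
theorem UPos.comulGen_support (h : PosGen I) {u v : List (PosGen I)} (huv : comulGen h u v ≠ 0) :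
    (mono u = 1 ∨ ∃ h' e, mono u = FreeAlgebra.ι ℂ h' * UPos.K e) ∧
      (mono v = 1 ∨ ∃ h' e, mono v = FreeAlgebra.ι ℂ h' * UPos.K e) := by
  have key : ∀ (h' : PosGen I) (e : ℤ) {w : List (PosGen I)},
      coeff (FreeAlgebra.ι ℂ h' * UPos.K e) w ≠ 0 →
      mono w = 1 ∨ ∃ h' e, mono w = FreeAlgebra.ι ℂ h' * UPos.K e :=
    fun h' e w hw => Or.inr ⟨h', e, UPos.mono_eq_of_coeff_ne_zero hw⟩
  have key' : ∀ (h' : PosGen I) {w : List (PosGen I)}, coeff (FreeAlgebra.ι ℂ h') w ≠ 0 →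
      mono w = 1 ∨ ∃ h' e, mono w = FreeAlgebra.ι ℂ h' * UPos.K e :=
    fun h' w hw => key h' 0 (by simpa [UPos.K, zpowWith] using hw)
  have key1 : ∀ {w : List (PosGen I)}, coeff (1 : UPos I) w ≠ 0 →
      mono w = 1 ∨ ∃ h' e, mono w = FreeAlgebra.ι ℂ h' * UPos.K e := by
    classical
    intro w hw
    rw [← mono_nil, coeff_mono] at hw
    by_cases h0 : w = []
    · exact Or.inl (by rw [h0, mono_nil])
    · exact absurd (if_neg h0) hw
  cases h with
  | x i n =>
    rw [comulGen] at huv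
    by_cases h0 : tmul (x i n) 1 u v = 0
    · rw [h0, zero_add] at huv
      obtain ⟨k, hk⟩ : ∃ k : ℕ, tmul (phi i k * K (-(2 * n + k))) (x i (n + k)) u v ≠ 0 := by
        by_contra! h1
        exact huv (finsum_eq_zero_of_forall_eq_zero h1)
      exact ⟨key _ _ (left_ne_zero_of_mul hk), key' _ (right_ne_zero_of_mul hk)⟩
    · exact ⟨key' _ (left_ne_zero_of_mul h0), key1 (right_ne_zero_of_mul h0)⟩
  | phi i k =>
    obtain ⟨p, _, hp⟩ := Finset.exists_ne_zero_of_sum_ne_zero huv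
    exact ⟨key _ _ (left_ne_zero_of_mul hp), key _ _ (right_ne_zero_of_mul hp)⟩
  | _ => exact ⟨key' _ (left_ne_zero_of_mul huv), key' _ (right_ne_zero_of_mul huv)⟩

/-- A letter `a` pairs with words by induction on the length of the word, through the coproduct of
`a`; then words `a` pair with all elements, by induction on the length of `a`. -/
theorem pairing_unique (hP : IsWeakHopfPairing P) (hP' : IsWeakHopfPairing P')
    (hG : IsQGraded P) (hG' : IsQGraded P') (hV : HasPrescribedValues q Q P)
    (hV' : HasPrescribedValues q Q P') (hQ : ∀ i j, gCoeff Q i j 0 ≠ 0) : P = P' := by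
  -- If the pairings agree on all letters at `b`, they agree at `b` on the factors of coproducts.
  have hlift : ∀ b : UNeg I, (∀ h, P (FreeAlgebra.ι ℂ h) b = P' (FreeAlgebra.ι ℂ h) b) →
      ∀ u : List (PosGen I), (mono u = 1 ∨ ∃ h' e, mono u = FreeAlgebra.ι ℂ h' * UPos.K e) →
        P (mono u) b = P' (mono u) b := by
    rintro b hb u (hu | ⟨h', e, hu⟩)
    · rw [hu, hP.map_one_left, hP'.map_one_left]
    · rw [hu, hV.map_mul_K hP, hV'.map_mul_K hP', hb]
  have hletter : ∀ (w : List (NegGen I)) (h : PosGen I),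
      P (FreeAlgebra.ι ℂ h) (mono w) = P' (FreeAlgebra.ι ℂ h) (mono w) := by
    intro w
    induction w with
    | nil => intro h; rw [mono_nil, hP.map_one_right, hP'.map_one_right]
    | cons h' w ih =>
      intro h
      rw [mono_cons, hP.map_mul_right, hP'.map_mul_right]
      refine finsum_congr fun p => ?_
      simp only [UPos.comul, comulExt_ι]
      by_cases h0 : UPos.comulGen h p.1 p.2 = 0
      · rw [h0, zero_mul, zero_mul]
      · rw [hlift _ (fun h => pairing_ι_ι_unique hP hP' hG hG' hV hV' hQ h h') _
            (UPos.comulGen_support h h0).1,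
          hlift _ ih _ (UPos.comulGen_support h h0).2]
  refine linearMap_ext_mono fun w => ?_
  induction w with
  | nil => ext b; rw [mono_nil, hP.map_one_left, hP'.map_one_left]
  | cons h w ih =>
    ext b
    rw [mono_cons, hP.map_mul_left, hP'.map_mul_left]
    exact finsum_congr fun p => by rw [hletter, ih]

end Uniqueness

end QuantumAffine

end

theorem proposition3 {I : Type*} [Fintype I] [DecidableEq I]
    (A : Matrix I I ℤ) (hA : QuantumAffine.IsSimpleCartanMatrix A)
    (B : Matrix I I ℚ) (hB : QuantumAffine.IsNormalizedForm A B)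
    (q h : ℂ) (hq : q = Complex.exp h) (hgen : ∀ n : ℕ, 0 < n → q ^ n ≠ 1) :
    ∃ P : QuantumAffine.UPos I →ₗ[ℂ] QuantumAffine.UNeg I →ₗ[ℂ] ℂ,
      (QuantumAffine.IsWeakHopfPairing P ∧ QuantumAffine.IsQGraded P ∧
        QuantumAffine.HasPrescribedValues q (QuantumAffine.qij h B) P) ∧
      (∀ P' : QuantumAffine.UPos I →ₗ[ℂ] QuantumAffine.UNeg I →ₗ[ℂ] ℂ,
        QuantumAffine.IsWeakHopfPairing P' → QuantumAffine.IsQGraded P' →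
        QuantumAffine.HasPrescribedValues q (QuantumAffine.qij h B) P' → P' = P) ∧
      (∀ r : QuantumAffine.UPos I, QuantumAffine.UPos.Rel (QuantumAffine.qij h B) r →
        ∀ b : QuantumAffine.UNeg I, P r b = 0) ∧
      (∀ r : QuantumAffine.UNeg I, QuantumAffine.UNeg.Rel (QuantumAffine.qij h B) r →
        ∀ a : QuantumAffine.UPos I, P a r = 0) := by
  open QuantumAffine in
  set Q := qij h B with hQ
  set g : I → I → PowerSeries ℂ := fun i j => gSeries (Q i j) with hgdef
  have hg0 : ∀ i j, PowerSeries.constantCoeff (g i j) ≠ 0 := fun i j =>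
    constantCoeff_gSeries (Complex.exp_ne_zero _)
  have hg : ∀ i j, g i j = g j i := fun i j => by
    simp only [hgdef, hQ, qij, hB.symm i j]
  have hgg : ∀ i j, g i j * (g i j)⁻¹ = 1 := fun i j => PowerSeries.mul_inv_cancel _ (hg0 i j)
  have hgQ : ∀ i j, g i j = gSeries (Q i j) := fun i j => rfl
  have hQ0 : ∀ i j, gCoeff Q i j 0 ≠ 0 := fun i j => by
    rw [gCoeff, PowerSeries.coeff_zero_eq_constantCoeff_apply]
    exact hg0 i j
  set c : ℂ := -1 / (q + q⁻¹)
  have hP := isWeakHopfPairing_pairing (g' := fun i j => (g i j)⁻¹) c hg hgg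
  have hV : HasPrescribedValues q Q (pairing c g) := hasPrescribedValues_pairing hgQ hg
  refine ⟨pairing c g, ⟨hP, isQGraded_pairing c g, hV⟩, ?_, ?_, ?_⟩
  · exact fun P' hP' hG' hV' =>
      pairing_unique hP' hP hG' (isQGraded_pairing c g) hV' hV hQ0
  · intro r hr b
    rw [pairing_apply, UPos.form_comm c hg]
    exact UPos.form_rel (g' := fun i j => (g i j)⁻¹) c hgQ hg hgg hr _
  · intro r hr a
    exact UPos.form_rel (g' := fun i j => (g i j)⁻¹) c hgQ hg hgg (UNeg.toPos_rel hr) a
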